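/- **Setting.** Let $n\ge 2$ and let $M,\bar M$ be compact smooth $n$-manifolds. A *Kim--McCann structure* on $M\times\bar M$ consists of a closed set $\mathscr C\subset M\times\bar M$ (the cut locus) and a pseudo-Riemannian metric $h$ on $(M\times\bar M)\setminus\mathscr C$ which vanishes on pairs of vectors tangent to the same factor and such that near every point outside $\mathscr C$ there is a $C^4$ function $c$ with $h(V,\bar W)=-\tfrac12 V\bar W c$ for $V$ tangent to $M$ and $\bar W$ tangent to $\bar M$. Put $K=I_{TM}\oplus(-I_{T\bar M})$ and $\omega(\cdot,\cdot)=h(K\cdot,\cdot)$. Let $\mathbf k$ be the para-complex unit, $\mathbf k^2=1$, $\tau=\tfrac12(1+\mathbf k)$, $\bar\tau=\tfrac12(1-\mathbf k)$, $e^{\mathbf k t}=\cosh t+\mathbf k\sinh t$. A *GKM $n$-fold* is a Kim--McCann structure together with a non-vanishing para-holomorphic $(n,0)$-form $\Omega$ on $M\times\bar M$ (of class $C^1$), that is, $\Omega(V_1,\dots,KV_i,\dots,V_n)=\mathbf k\,\Omega(V_1,\dots,V_n)$ for every $i$ and, in local product coordinates $(x,\bar x)$, $$\Omega=\tau\,\rho(x)\,dx^1\wedge\dots\wedge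 dx^n+\bar\tau\,\bar\rho(\bar x)\,d\bar x^1\wedge\dots\wedge d\bar x^n .$$ Let $\psi$ be the real function defined outside $\mathscr C$ by $$e^{2n\psi}=\frac{\rho\bar\rho}{\det(-c_{i\bar s})}$$ (it is presupposed that the right-hand side is positive there). Let $F:L\to (M\times\bar M)\setminus\mathscr C$ be a ($C^2$) spacelike Lagrangian immersion of a smooth $n$-manifold $L$: the induced metric $g=F^*h$ is positive definite and $F^*\omega=0$. Let $d\mathrm{Vol}_L$ be the volume form of $g$ for the orientation of $L$ in which $\rho\,dx^1\wedge\dots\wedge dx^n|_L$ is positive. Let $\hat\nabla$ be the Levi-Civita connection of $h$ and also denote by $\hat\nabla\psi$ the $h$-gradient of $\psi$; let $\perp$ be the $h$-orthogonal projection onto the normal space of $L$, and let $\vec H=g^{ij}(\hat\nabla_{\partial_iF}\partial_jF)^\perp$ be the mean curvature vector. For a field $V$ of ambient vectors along $L$ let $\alpha_V$ be the one-form $\alpha_V(w)=\omega(V,dF(w))$ on $L$. **Proposition.** There is exactly one function $\theta:L\to\mathbb R$ (the Lagrangian angle) with $$\Omega|_L=e^{\mathbf k\theta+n\psi}\,d\mathrm{Vol}_L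 .$$ It is of class $C^1$ and satisfies $$d\theta=\alpha_{\vec H-n(\hat\nabla\psi)^\perp}.$$ In particular the generalized mean curvature form $\alpha_{\vec H-n(\hat\nabla\psi)^\perp}$ is exact on $L$, and the gradient $\nabla\theta$ of $\theta$ with respect to $g$ satisfies $$dF(\nabla\theta)=K\bigl(\vec H-n(\hat\nabla\psi)^\perp\bigr).$$ -/

import Mathlib

open scoped Manifold ContDiff Topology

noncomputable section

namespace KimMcCann

/-! ### Para-complex numbers -/

/-- The para-complex numbers `a + b k` with `k ^ 2 = 1`. -/
abbrev ParaComplex : Type := QuadraticAlgebra ℝ 1 0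

/-- The para-complex unit `k`. -/
def kUnit : ParaComplex := ⟨0, 1⟩

/-- `e ^ (k t) = cosh t + k sinh t`. -/
def expK (t : ℝ) : ParaComplex := ⟨Real.cosh t, Real.sinh t⟩

/-- The number `u` in the decomposition `τ u + τ' v`, where `τ = (1 + k) / 2`, `τ' = (1 - k) / 2`. -/
def tauPart (z : ParaComplex) : ℝ := z.re + z.im

/-- The number `v` in the decomposition `τ u + τ' v`, where `τ = (1 + k) / 2`, `τ' = (1 - k) / 2`. -/
def tauBarPart (z : ParaComplex) : ℝ := z.re - z.im

/-! ### The product manifold -/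

/-- The model space of an `n`-manifold. -/
abbrev E (n : ℕ) : Type := EuclideanSpace ℝ (Fin n)

/-- The model with corners of a product of two `n`-manifolds. -/
abbrev prodModel (n : ℕ) : ModelWithCorners ℝ (E n × E n) (ModelProd (E n) (E n)) :=
  (𝓡 n).prod (𝓡 n)

section Ambient

variable {n : ℕ}
  {M : Type*} [TopologicalSpace M] [ChartedSpace (E n) M]
  {N : Type*} [TopologicalSpace N] [ChartedSpace (E n) N]

/-- The tangent space of `M × N` at `z = (x, y)`, that is `T_x M × T_y N`. -/
abbrev Tan (n : ℕ) {M : Type*} [TopologicalSpace M] [ChartedSpace (E n) M]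
    {N : Type*} [TopologicalSpace N] [ChartedSpace (E n) N] (z : M × N) : Type :=
  TangentSpace (prodModel n) z

/-- The inclusion `T_x M → T_(x, y) (M × N)`, `v ↦ (v, 0)`. -/
def inl (z : M × N) (v : TangentSpace (𝓡 n) z.1) : Tan n z := ((v, 0) : E n × E n)

/-- The inclusion `T_y N → T_(x, y) (M × N)`, `w ↦ (0, w)`. -/
def inr (z : M × N) (w : TangentSpace (𝓡 n) z.2) : Tan n z := ((0, w) : E n × E n)

/-- The para-complex structure `K = I ⊕ (-I)`. -/
def K (z : M × N) (V : Tan n z) : Tan n z :=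
  ((show E n × E n from V).1, -(show E n × E n from V).2)

/-- The mixed second derivative `v w c`, for `v` tangent to `M` and `w` tangent to `N` at `z`. -/
def mixedDeriv (c : M × N → ℝ) (z : M × N)
    (v : TangentSpace (𝓡 n) z.1) (w : TangentSpace (𝓡 n) z.2) : ℝ :=
  mfderiv (𝓡 n) 𝓘(ℝ, ℝ)
    (fun x : M => (mfderiv (𝓡 n) 𝓘(ℝ, ℝ) (fun y : N => c (x, y)) z.2 w : ℝ)) z.1 v

/-- The inverse `χ⁻¹` of the preferred product chart `χ` of `M × N` at `z₀`. -/
def unchart (n : ℕ) {M : Type*} [TopologicalSpace M] [ChartedSpace (E n) M]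
    {N : Type*} [TopologicalSpace N] [ChartedSpace (E n) N] (z₀ : M × N) : E n × E n → M × N :=
  (extChartAt (prodModel n) z₀).symm

/-- The differential of `unchart n z₀` at the point `y` of the chart: it sends a coordinate vector
to the tangent vector of `M × N` with these coordinates. -/
def dUnchart (z₀ : M × N) (y a : E n × E n) : Tan n (unchart n z₀ y) :=
  mfderiv 𝓘(ℝ, E n × E n) (prodModel n) (unchart n z₀) y a

/-- The vector `B`-dual to the functional `φ`: the `v` with `B v w = φ w` for all `w`. It exists and
is unique when `B` is nondegenerate on a finite-dimensional space; elsewhere it is a junk value. -/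
def sharp {V : Type*} [AddCommGroup V] [Module ℝ V] (B : LinearMap.BilinForm ℝ V) (φ : V → ℝ) : V :=
  Classical.epsilon fun v => ∀ w, B v w = φ w

end Ambient

/-! ### Kim-McCann manifolds -/

/-- A Kim-McCann structure on `M × N`: off a closed cut locus, a pseudo-Riemannian metric `h` which
vanishes on pairs of vectors tangent to the same factor and which is locally given by
`h (V, W) = - (1 / 2) V W c`, for `V` tangent to `M` and `W` tangent to `N`, with a local function
`c` of class `C ^ 4`. The values of `h` on the cut locus carry no meaning. -/
structure KMStructure (n : ℕ) (M N : Type*) [TopologicalSpace M] [ChartedSpace (E n) M]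
    [TopologicalSpace N] [ChartedSpace (E n) N] where
  cutLocus : Set (M × N)
  isClosed_cutLocus : IsClosed cutLocus
  h : ∀ z : M × N, LinearMap.BilinForm ℝ (Tan n z)
  symm : ∀ z, z ∉ cutLocus → ∀ V W, h z V W = h z W V
  nondegenerate : ∀ z, z ∉ cutLocus → ∀ V, (∀ W, h z V W = 0) → V = 0
  inl_inl : ∀ z, z ∉ cutLocus → ∀ v w, h z (inl z v) (inl z w) = 0
  inr_inr : ∀ z, z ∉ cutLocus → ∀ v w, h z (inr z v) (inr z w) = 0
  exists_cost : ∀ z, z ∉ cutLocus → ∃ c : M × N → ℝ,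
    ContMDiffAt (prodModel n) 𝓘(ℝ, ℝ) 4 c z ∧
      ∀ᶠ z' in 𝓝 z, ∀ v w, h z' (inl z' v) (inr z' w) = -(1 / 2) * mixedDeriv c z' v w

/-- Para-complex valued `n`-forms on `M × N`. -/
abbrev ParaForm (n : ℕ) (M N : Type*) [TopologicalSpace M] [ChartedSpace (E n) M]
    [TopologicalSpace N] [ChartedSpace (E n) N] : Type _ :=
  ∀ z : M × N, (Tan n z) [⋀^Fin n]→ₗ[ℝ] ParaComplex

section Forms

variable {n : ℕ}
  {M : Type*} [TopologicalSpace M] [ChartedSpace (E n) M]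
  {N : Type*} [TopologicalSpace N] [ChartedSpace (E n) N]

/-- `Ω` is of type `(n, 0)`: `k Ω(V₁, …, Vₙ) = Ω(V₁, …, K Vᵢ, …, Vₙ)` for every `i`. -/
def IsTypeN0 (Ω : ParaForm n M N) : Prop :=
  ∀ (z : M × N) (V : Fin n → Tan n z) (i : Fin n),
    Ω z (Function.update V i (K z (V i))) = kUnit * Ω z V

/-- The coefficient `f` of an `(n, 0)`-form `Ω = f dz¹ ∧ … ∧ dzⁿ` in the preferred product chart
`(x, x')` at `z₀`, where `dzⁱ = τ dxⁱ + τ' dx'ⁱ`. As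
`dz¹ ∧ … ∧ dzⁿ = τ dx¹ ∧ … ∧ dxⁿ + τ' dx'¹ ∧ … ∧ dx'ⁿ`, it is the sum of the values of `Ω` on the
two coordinate frames `∂/∂xⁱ` and `∂/∂x'ⁱ`. -/
def coeff (Ω : ParaForm n M N) (z₀ : M × N) (y : E n × E n) : ParaComplex :=
  Ω (unchart n z₀ y) (fun i => dUnchart z₀ y (EuclideanSpace.single i 1, 0)) +
    Ω (unchart n z₀ y) (fun i => dUnchart z₀ y (0, EuclideanSpace.single i 1))

/-- `Ω` is a para-holomorphic `(n, 0)`-form: it is of type `(n, 0)` and in product charts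
`Ω = f dz¹ ∧ … ∧ dzⁿ` with `f = τ u + τ' v` of class `C ^ 1` and satisfying the Cauchy-Riemann
equations: `u` has no derivative in the directions of `N`, and `v` has none in those of `M`. Thus,
locally, `Ω = τ u(x) dx + τ' v(x') dx'`. -/
structure IsParaHolomorphic (Ω : ParaForm n M N) : Prop where
  isTypeN0 : IsTypeN0 Ω
  contDiffOn_u : ∀ z₀ : M × N, ContDiffOn ℝ 1 (fun y => tauPart (coeff Ω z₀ y))
    (extChartAt (prodModel n) z₀).target
  contDiffOn_v : ∀ z₀ : M × N, ContDiffOn ℝ 1 (fun y => tauBarPart (coeff Ω z₀ y))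
    (extChartAt (prodModel n) z₀).target
  cauchyRiemann_u : ∀ z₀ : M × N, ∀ y ∈ (extChartAt (prodModel n) z₀).target, ∀ w : E n,
    fderiv ℝ (fun y => tauPart (coeff Ω z₀ y)) y (0, w) = 0
  cauchyRiemann_v : ∀ z₀ : M × N, ∀ y ∈ (extChartAt (prodModel n) z₀).target, ∀ w : E n,
    fderiv ℝ (fun y => tauBarPart (coeff Ω z₀ y)) y (w, 0) = 0

end Forms

/-- A generalized Kim-McCann structure: a Kim-McCann structure with a non-vanishing para-holomorphic
`(n, 0)`-form `Ω`. -/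
structure GKMStructure (n : ℕ) (M N : Type*) [TopologicalSpace M] [ChartedSpace (E n) M]
    [TopologicalSpace N] [ChartedSpace (E n) N] extends KMStructure n M N where
  Omega : ParaForm n M N
  isParaHolomorphic : IsParaHolomorphic Omega
  Omega_ne_zero : ∀ z, Omega z ≠ 0

section Geometry

variable {n : ℕ}
  {M : Type*} [TopologicalSpace M] [ChartedSpace (E n) M]
  {N : Type*} [TopologicalSpace N] [ChartedSpace (E n) N]
  {L : Type*} [TopologicalSpace L] [ChartedSpace (E n) L]

/-- The para-Kähler form `ω(V, W) = h(K V, W)`. -/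
def KMStructure.omega (X : KMStructure n M N) (z : M × N) (V W : Tan n z) : ℝ :=
  X.h z (K z V) W

/-- The function `ψ` of a generalized Kim-McCann manifold, defined off the cut locus by
`e ^ (2 n ψ) = ρ ρ' / det (- c_is)`, where `Ω = τ ρ dx + τ' ρ' dx'`. Here
`- c_is = 2 h(∂ᵢ, ∂'ₛ)`, `ρ` is the `τ`-part of `Ω` on the frame `∂ᵢ` and `ρ'` the `τ'`-part of `Ω`
on the frame `∂'ₛ`; both sides are alternating in the two frames, which can be arbitrary. -/
def GKMStructure.IsPsi (X : GKMStructure n M N) (ψ : M × N → ℝ) : Prop :=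
  ∀ z, z ∉ X.cutLocus →
    ∀ (e : Fin n → TangentSpace (𝓡 n) z.1) (e' : Fin n → TangentSpace (𝓡 n) z.2),
      Real.exp (2 * n * ψ z) *
          Matrix.det (Matrix.of fun i s => 2 * X.h z (inl z (e i)) (inr z (e' s))) =
        tauPart (X.Omega z fun i => inl z (e i)) * tauBarPart (X.Omega z fun s => inr z (e' s))

/-! ### The Levi-Civita connection of the Kim-McCann metric -/

/-- The metric `h` in the preferred product chart at `z₀`, at the point `y` of the chart. -/
def KMStructure.hChart (X : KMStructure n M N) (z₀ : M × N) (y a b : E n × E n) : ℝ :=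
  X.h (unchart n z₀ y) (dUnchart z₀ y a) (dUnchart z₀ y b)

/-- The derivative at `z₀` in the direction `a` of the component `h(b, c)` of the metric in the
preferred product chart at `z₀`. -/
def KMStructure.dh (X : KMStructure n M N) (z₀ : M × N) (a b c : E n × E n) : ℝ :=
  fderiv ℝ (fun y => X.hChart z₀ y b c) (extChartAt (prodModel n) z₀ z₀) a

/-- The Christoffel symbols `Γ(a, b)` of `h` at `z₀` in the preferred product chart at `z₀`:
`h(Γ(a, b), c) = (∂_a h(b, c) + ∂_b h(a, c) - ∂_c h(a, b)) / 2`. -/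
def KMStructure.christoffel (X : KMStructure n M N) (z₀ : M × N) (a b : Tan n z₀) : Tan n z₀ :=
  sharp (X.h z₀) fun c => (X.dh z₀ a b c + X.dh z₀ b a c - X.dh z₀ c a b) / 2

/-- The ambient gradient `∇̂ f`. -/
def KMStructure.grad (X : KMStructure n M N) (f : M × N → ℝ) (z : M × N) : Tan n z :=
  sharp (X.h z) fun W => (mfderiv (prodModel n) 𝓘(ℝ, ℝ) f z W : ℝ)

/-! ### Immersed submanifolds -/

/-- The differential of `F : L → M × N`. -/
def dF (F : L → M × N) (p : L) : TangentSpace (𝓡 n) p →ₗ[ℝ] Tan n (F p) :=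
  (mfderiv (𝓡 n) (prodModel n) F p).toLinearMap

/-- The coordinate vectors `∂ᵢ` at `p` of the preferred chart of `L` at `p`. -/
def coordVec (p : L) (i : Fin n) : TangentSpace (𝓡 n) p := (EuclideanSpace.single i 1 : E n)

/-- The induced metric `g = F^* h`. -/
def KMStructure.g (X : KMStructure n M N) (F : L → M × N) (p : L) :
    LinearMap.BilinForm ℝ (TangentSpace (𝓡 n) p) :=
  (X.h (F p)).compl₁₂ (dF F p) (dF F p)

/-- `F : L → M × N` is a spacelike Lagrangian immersion which avoids the cut locus. That `F` is an
immersion is part of its being spacelike; `L` has half the dimension of `M × N`. -/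
structure KMStructure.IsSpacelikeLagrangian (X : KMStructure n M N) (F : L → M × N) : Prop where
  contMDiff : ContMDiff (𝓡 n) (prodModel n) 2 F
  notMem_cutLocus : ∀ p, F p ∉ X.cutLocus
  spacelike : ∀ (p : L) (v : TangentSpace (𝓡 n) p), v ≠ 0 → 0 < X.g F p v v
  lagrangian : ∀ (p : L) (v w : TangentSpace (𝓡 n) p), X.omega (F p) (dF F p v) (dF F p w) = 0

/-- The normal part `V^⊥` of an ambient vector `V` at a point of `L`: `V` minus the image of the
vector `t` of `T_p L` with `g(t, w) = h(V, dF w)` for all `w`. -/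
def KMStructure.normalPart (X : KMStructure n M N) (F : L → M × N) (p : L) (V : Tan n (F p)) :
    Tan n (F p) :=
  V - dF F p (sharp (X.g F p) fun w => X.h (F p) V (dF F p w))

/-- The covariant derivative `∇̂_{Fᵢ} Fⱼ = ∂ᵢ ∂ⱼ F + Γ(Fᵢ, Fⱼ)` at `p`, for `Fᵢ = ∂ᵢ F` with respect
to the preferred charts at `p` and `F p`. -/
def KMStructure.covDeriv (X : KMStructure n M N) (F : L → M × N) (p : L) (i j : Fin n) :
    Tan n (F p) :=
  (show Tan n (F p) from
    fderiv ℝ (fun x => fderiv ℝ (writtenInExtChartAt (𝓡 n) (prodModel n) p F) x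
      (EuclideanSpace.single j 1)) (extChartAt (𝓡 n) p p) (EuclideanSpace.single i 1)) +
  X.christoffel (F p) (dF F p (coordVec p i)) (dF F p (coordVec p j))

/-- The mean curvature vector `H = g^{ij} (∇̂_{Fᵢ} Fⱼ)^⊥`. -/
def KMStructure.meanCurvature (X : KMStructure n M N) (F : L → M × N) (p : L) : Tan n (F p) :=
  ∑ i : Fin n, ∑ j : Fin n,
    (Matrix.of fun i j => X.g F p (coordVec p i) (coordVec p j))⁻¹ i j •
      X.normalPart F p (X.covDeriv F p i j)

/-- The generalized mean curvature vector `H - n (∇̂ ψ)^⊥`. -/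
def KMStructure.genMeanCurvature (X : KMStructure n M N) (ψ : M × N → ℝ) (F : L → M × N) (p : L) :
    Tan n (F p) :=
  X.meanCurvature F p - (n : ℝ) • X.normalPart F p (X.grad ψ (F p))

/-- The one-form `α_V = ω(V, ·)` on `L`, for a field `V` of ambient vectors along `L`. -/
def KMStructure.alpha (X : KMStructure n M N) (F : L → M × N) (V : ∀ p, Tan n (F p)) (p : L)
    (w : TangentSpace (𝓡 n) p) : ℝ :=
  X.omega (F p) (V p) (dF F p w)

/-- The intrinsic gradient `∇ θ` of a function on `L`, for the induced metric. -/
def KMStructure.gradL (X : KMStructure n M N) (F : L → M × N) (θ : L → ℝ) (p : L) :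
    TangentSpace (𝓡 n) p :=
  sharp (X.g F p) fun w => (mfderiv (𝓡 n) 𝓘(ℝ, ℝ) θ p w : ℝ)

/-- The Riemannian volume form `dVol_L` of the induced metric, for the orientation of `L` in which
`ρ dx` (the `τ`-part of `Ω`) is positive on `L`: on vectors `v₁, …, vₙ` it is
`± √ det (g(vᵢ, vⱼ))`, with the sign of `ρ dx (dF v₁, …, dF vₙ)`. -/
def GKMStructure.dVol (X : GKMStructure n M N) (F : L → M × N) (p : L)
    (v : Fin n → TangentSpace (𝓡 n) p) : ℝ :=
  Real.sign (tauPart (X.Omega (F p) fun i => dF F p (v i))) *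
    Real.sqrt (Matrix.det (Matrix.of fun i j => X.g F p (v i) (v j)))

/-- `θ` is the Lagrangian angle of `L`: `Ω|_L = e ^ (k θ + n ψ) dVol_L`. -/
def GKMStructure.IsLagrangianAngle (X : GKMStructure n M N) (ψ : M × N → ℝ) (F : L → M × N)
    (θ : L → ℝ) : Prop :=
  ∀ (p : L) (v : Fin n → TangentSpace (𝓡 n) p),
    X.Omega (F p) (fun i => dF F p (v i)) =
      (Real.exp (n * ψ (F p)) * X.dVol F p v) • expK (θ p)

/-- The one-form `α` on `L` is exact: it is `dφ` for a function `φ` of class `C ^ 1`. -/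
def IsExact (α : ∀ p : L, TangentSpace (𝓡 n) p → ℝ) : Prop :=
  ∃ φ : L → ℝ, ContMDiff (𝓡 n) 𝓘(ℝ, ℝ) 1 φ ∧ ∀ p w, mfderiv (𝓡 n) 𝓘(ℝ, ℝ) φ p w = α p w

end Geometry

end KimMcCann

end

/-!
Write `Ω = τ ρ dx + τ' ρ' dx'` near a point of `F(L)`, let `A` and `A'` be the matrices of the two
components of `dF` in product coordinates, and let `b(u, v) = h((u, 0), (0, v))`, which is
`-(1 / 2)` times the mixed second derivative of the cost.

*Existence and uniqueness.* Since `F` is Lagrangian, `g(v, w) = 2 b(A v, A' w)`. The defining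
relation of `ψ`, applied to the frames `A vᵢ` and `A' vᵢ`, therefore says that the product of the
`τ`-part and the `τ'`-part of `Ω(dF v₁, …, dF vₙ)` is `e^{2nψ} det g(vᵢ, vⱼ)`
(`GKMStructure.tauPart_mul_tauBarPart`), which is positive on a basis. So the two parts are
`e^{nψ} dVol e^{±θ}` exactly for half the logarithm `θ` of their quotient
(`GKMStructure.isLagrangianAngle_iff`).

*The differential.* Locally `2 θ = log (ρ det A) - log (ρ' det A')` and
`2 n ψ = log (ρ ρ') - log det (2 b)`. Jacobi's formula turns the derivatives of the determinants
into traces, which are traces with respect to `g` because `g = Aᵀ (2 b) A'`. Differentiating the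
Lagrangian condition `b(A v, A' w) = b(A w, A' v)` along `L` (`lagrangian_fderiv`) exchanges the
differentiated index with a traced one, and the symmetry of the third derivatives of the cost
(`dCostForm_inl_swap`, `dCostForm_inr_swap`) identifies the remaining terms. The result is
`dθ(w) = g^{ij} curvatureTerm(i, j, w) + n dψ(K dF w)` (`fderiv_angle`).

On the other hand the Koszul formula in the same coordinates gives
`h(∇̂ᵢ Fⱼ, K dF w) = -curvatureTerm(i, j, w)`
(`KMStructure.IsSpacelikeLagrangian.h_covDeriv`). As `K` is an anti-isometry which maps tangent
vectors of `L` to normal ones, `ω(V^⊥, dF w) = -h(V, K dF w)` for every ambient vector `V`. Hence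
the expression found for `dθ(w)` is `ω(H - n (∇̂ψ)^⊥, dF w)`
(`GKMStructure.alpha_genMeanCurvature`).

*The gradient.* `dF(TL)` and `K dF(TL)` span the ambient tangent space, and `dF(∇θ)` and
`K (H - n (∇̂ψ)^⊥)` have the same pairings with both
(`KMStructure.IsSpacelikeLagrangian.dF_eq_K`).
-/

noncomputable section

namespace KimMcCann

/-! ### Determinants and bilinear forms -/

section LogDet

variable {V : Type*} [NormedAddCommGroup V] [NormedSpace ℝ V] {m : Type*}
  [Fintype m] [DecidableEq m]

/-- Jacobi's formula `d det A = tr (adj A dA)`. -/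
theorem hasFDerivAt_det {A : V → Matrix m m ℝ} {A' : m → m → V →L[ℝ] ℝ} {x : V}
    (hA : ∀ i j, HasFDerivAt (fun y => A y i j) (A' i j) x) :
    HasFDerivAt (fun y => (A y).det) (∑ j, ∑ i, (A x).adjugate j i • A' i j) x := by
  have h1 : HasFDerivAt (fun y => (A y).det)
      (∑ σ : Equiv.Perm m, (Equiv.Perm.sign σ : ℝ) •
        ∑ j, (∏ i ∈ Finset.univ.erase j, A x (σ i) i) • A' (σ j) j) x := by
    simp only [Matrix.det_apply']
    refine HasFDerivAt.fun_sum fun σ _ => ?_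
    exact (HasFDerivAt.finsetProd (fun i _ => hA (σ i) i)).const_mul _
  convert h1 using 1
  have key : ∀ (j : m) (a : m → ℝ), ∑ i, (A x).adjugate j i * a i =
      ∑ σ : Equiv.Perm m, (Equiv.Perm.sign σ : ℝ) *
        ((∏ i ∈ Finset.univ.erase j, A x (σ i) i) * a (σ j)) := by
    intro j a
    -- expansion along column `j` (Cramer's rule)
    have h2 : ∑ i, (A x).adjugate j i * a i = ((A x).updateCol j a).det := by
      rw [← Matrix.cramer_apply, Matrix.cramer_eq_adjugate_mulVec]
      rfl
    rw [h2, Matrix.det_apply']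
    refine Finset.sum_congr rfl fun σ _ => ?_
    rw [← Finset.mul_prod_erase _ _ (Finset.mem_univ j), Matrix.updateCol_self, mul_comm (a _)]
    congr 2
    refine Finset.prod_congr rfl fun i hi => ?_
    rw [Matrix.updateCol_ne (Finset.ne_of_mem_erase hi)]
  ext w
  simp only [sum_apply, smul_apply, smul_eq_mul]
  simp only [key _ fun i => A' i _ w, Finset.mul_sum]
  exact Finset.sum_comm

/-- Jacobi's formula `d log |det A| = tr (A⁻¹ dA)`. -/
theorem hasFDerivAt_log_det {A : V → Matrix m m ℝ} {A' : m → m → V →L[ℝ] ℝ} {x : V}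
    (hA : ∀ i j, HasFDerivAt (fun y => A y i j) (A' i j) x) (hx : (A x).det ≠ 0) :
    ∃ D : V →L[ℝ] ℝ, HasFDerivAt (fun y => Real.log (A y).det) D x ∧
      ∀ w, D w = ((A x)⁻¹ * Matrix.of fun i j => A' i j w).trace := by
  refine ⟨_, (hasFDerivAt_det hA).log hx, fun w => ?_⟩
  simp only [sum_apply, smul_apply, smul_eq_mul,
    Matrix.inv_def, Ring.inverse_eq_inv', Matrix.trace, Matrix.diag, Matrix.mul_apply,
    Matrix.smul_apply, Matrix.of_apply, Finset.mul_sum, mul_assoc]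

end LogDet

section Gram

variable {n : ℕ}

/-- The matrix with columns `a₁, …, aₙ`. -/
def colMatrix (a : Fin n → E n) : Matrix (Fin n) (Fin n) ℝ := Matrix.of fun i j => a j i

/-- The matrix of a bilinear form in the standard basis. -/
def formMatrix (B : E n →ₗ[ℝ] E n →ₗ[ℝ] ℝ) : Matrix (Fin n) (Fin n) ℝ :=
  Matrix.of fun i s => B (EuclideanSpace.single i 1) (EuclideanSpace.single s 1)

theorem eq_sum_single (u : E n) : u = ∑ i, u i • EuclideanSpace.single i (1 : ℝ) := by
  conv_lhs => rw [← (EuclideanSpace.basisFun (Fin n) ℝ).sum_repr u]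
  simp

theorem gram_eq_mul (B : E n →ₗ[ℝ] E n →ₗ[ℝ] ℝ) (a b : Fin n → E n) :
    (Matrix.of fun i j => B (a i) (b j)) =
      (colMatrix a).transpose * formMatrix B * colMatrix b := by
  ext i j
  rw [Matrix.of_apply]
  conv_lhs => rw [eq_sum_single (a i), eq_sum_single (b j)]
  simp only [map_sum, map_smul, LinearMap.sum_apply, LinearMap.smul_apply, Matrix.mul_apply,
    colMatrix, formMatrix, Matrix.transpose_apply, Matrix.of_apply, smul_eq_mul, Finset.mul_sum,
    Finset.sum_mul]
  refine Finset.sum_congr rfl fun k _ => Finset.sum_congr rfl fun l _ => by ring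

variable {B : E n →ₗ[ℝ] E n →ₗ[ℝ] ℝ} {a b : Fin n → E n}

theorem det_ne_zero_of_gram (hG : (Matrix.of fun i j => B (a i) (b j)).det ≠ 0) :
    (colMatrix a).det ≠ 0 ∧ (formMatrix B).det ≠ 0 ∧ (colMatrix b).det ≠ 0 := by
  rw [gram_eq_mul, Matrix.det_mul, Matrix.det_mul, Matrix.det_transpose] at hG
  refine ⟨fun h => ?_, fun h => ?_, fun h => ?_⟩ <;> simp [h] at hG

/-- If `g = aᵀ B b`, then `tr (b⁻¹ b') = tr (g⁻¹ aᵀ B b')`. -/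
theorem trace_inv_mul_right (hG : (Matrix.of fun i j => B (a i) (b j)).det ≠ 0)
    (b' : Fin n → E n) :
    ((colMatrix b)⁻¹ * colMatrix b').trace =
      ∑ i, ∑ j, (Matrix.of fun i j => B (a i) (b j))⁻¹ i j * B (a j) (b' i) := by
  obtain ⟨ha, hB, hb⟩ := det_ne_zero_of_gram hG
  have h1 : (colMatrix b)⁻¹ * colMatrix b' = (Matrix.of fun i j => B (a i) (b j))⁻¹ *
      Matrix.of fun i j => B (a i) (b' j) := by
    rw [gram_eq_mul, gram_eq_mul, Matrix.mul_inv_rev, mul_assoc, Matrix.nonsing_inv_mul_cancel_left]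
    simpa using ⟨ha, hB⟩
  rw [h1]
  simp [Matrix.trace, Matrix.mul_apply]

theorem trace_inv_mul_left (hG : (Matrix.of fun i j => B (a i) (b j)).det ≠ 0)
    (hs : ∀ i j, B (a i) (b j) = B (a j) (b i)) (a' : Fin n → E n) :
    ((colMatrix a)⁻¹ * colMatrix a').trace =
      ∑ i, ∑ j, (Matrix.of fun i j => B (a i) (b j))⁻¹ i j * B (a' i) (b j) := by
  have h := trace_inv_mul_right (B := B.flip) (a := b) (b := a)
    (by simpa only [LinearMap.flip_apply, ← hs] using hG) a'
  simpa only [LinearMap.flip_apply, ← hs] using h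

/-- If `g = aᵀ B b`, then `tr (B⁻¹ B') = tr (g⁻¹ aᵀ B' b)`. -/
theorem trace_inv_mul_form (hG : (Matrix.of fun i j => B (a i) (b j)).det ≠ 0)
    (B' : E n →ₗ[ℝ] E n →ₗ[ℝ] ℝ) :
    ((formMatrix B)⁻¹ * formMatrix B').trace =
      ∑ i, ∑ j, (Matrix.of fun i j => B (a i) (b j))⁻¹ i j * B' (a j) (b i) := by
  obtain ⟨ha, hB, hb⟩ := det_ne_zero_of_gram hG
  have h1 : (Matrix.of fun i j => B (a i) (b j))⁻¹ * (Matrix.of fun i j => B' (a i) (b j)) =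
      (colMatrix b)⁻¹ * ((formMatrix B)⁻¹ * formMatrix B' * colMatrix b) := by
    rw [gram_eq_mul, gram_eq_mul, Matrix.mul_inv_rev, Matrix.mul_inv_rev]
    simp only [mul_assoc]
    rw [Matrix.nonsing_inv_mul_cancel_left]
    simpa using ha
  have h2 : ((formMatrix B)⁻¹ * formMatrix B').trace =
      ((Matrix.of fun i j => B (a i) (b j))⁻¹ * (Matrix.of fun i j => B' (a i) (b j))).trace := by
    rw [h1, Matrix.trace_mul_comm (colMatrix b)⁻¹, mul_assoc _ (colMatrix b),
      Matrix.mul_nonsing_inv _ (by simpa using hb), mul_one]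
  rw [h2]
  simp [Matrix.trace, Matrix.mul_apply]

/-- As `g` is symmetric, the two indices in `trace_inv_mul_form` can be exchanged. -/
theorem trace_inv_mul_form' (hG : (Matrix.of fun i j => B (a i) (b j)).det ≠ 0)
    (hs : ∀ i j, B (a i) (b j) = B (a j) (b i)) (B' : E n →ₗ[ℝ] E n →ₗ[ℝ] ℝ) :
    ((formMatrix B)⁻¹ * formMatrix B').trace =
      ∑ i, ∑ j, (Matrix.of fun i j => B (a i) (b j))⁻¹ i j * B' (a i) (b j) := by
  rw [trace_inv_mul_form hG, Finset.sum_comm]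
  have ht : (Matrix.of fun i j => B (a i) (b j))⁻¹.transpose =
      (Matrix.of fun i j => B (a i) (b j))⁻¹ := by
    rw [Matrix.transpose_nonsing_inv]
    congr 1
    ext i j
    exact hs j i
  refine Finset.sum_congr rfl fun i _ => Finset.sum_congr rfl fun j _ => ?_
  rw [← ht, Matrix.transpose_apply, ht]

end Gram

/-! ### The metric in product coordinates -/

section Coordinates

variable {n : ℕ}

/-- The mixed part `(u, v) ↦ -(1 / 2) Φ((u, 0), (0, v))` of a bilinear form `Φ` on `ℝⁿ × ℝⁿ`. -/
def crossForm (Φ : (E n × E n) →L[ℝ] (E n × E n) →L[ℝ] ℝ) : E n →ₗ[ℝ] E n →ₗ[ℝ] ℝ :=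
  LinearMap.mk₂ ℝ (fun u v => -(1 / 2) * Φ (u, 0) (0, v))
    (fun u u' v => by
      rw [show ((u + u', 0) : E n × E n) = (u, 0) + (u', 0) by simp, map_add]
      simp [mul_add])
    (fun r u v => by
      rw [show ((r • u, 0) : E n × E n) = r • (u, 0) by simp, map_smul]
      simp; ring)
    (fun u v v' => by
      rw [show ((0, v + v') : E n × E n) = (0, v) + (0, v') by simp, map_add]
      ring)
    (fun r u v => by
      rw [show ((0, r • v) : E n × E n) = r • (0, v) by simp, map_smul]
      simp; ring)

theorem crossForm_apply (Φ : (E n × E n) →L[ℝ] (E n × E n) →L[ℝ] ℝ) (u v : E n) :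
    crossForm Φ u v = -(1 / 2) * Φ (u, 0) (0, v) := rfl

/-- The form `(u, v) ↦ -(1 / 2) D²c(y)((u, 0), (0, v))`, which is the Kim-McCann metric in
coordinates. -/
def costForm (c : E n × E n → ℝ) (y : E n × E n) : E n →ₗ[ℝ] E n →ₗ[ℝ] ℝ :=
  crossForm (fderiv ℝ (fderiv ℝ c) y)

/-- The derivative of `costForm c` at `y` in the direction `a`. -/
def dCostForm (c : E n × E n → ℝ) (y a : E n × E n) : E n →ₗ[ℝ] E n →ₗ[ℝ] ℝ :=
  crossForm (fderiv ℝ (fderiv ℝ (fderiv ℝ c)) y a)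

variable {c : E n × E n → ℝ} {y : E n × E n}

theorem contDiffAt_hessian (hc : ContDiffAt ℝ 4 c y) : ContDiffAt ℝ 2 (fderiv ℝ (fderiv ℝ c)) y :=
  (hc.fderiv_right (m := 3) (by norm_num)).fderiv_right (by norm_num)

theorem hasFDerivAt_costForm (hc : ContDiffAt ℝ 4 c y) (u v : E n) :
    ∃ D : E n × E n →L[ℝ] ℝ, HasFDerivAt (fun y => costForm c y u v) D y ∧
      ∀ a, D a = dCostForm c y a u v := by
  have h := ((contDiffAt_hessian hc).differentiableAt (by norm_num)).hasFDerivAt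
  refine ⟨_, ((h.clm_apply (hasFDerivAt_const ((u, 0) : E n × E n) y)).clm_apply
    (hasFDerivAt_const ((0, v) : E n × E n) y)).const_mul (-(1 / 2)), fun a => ?_⟩
  simp [dCostForm, crossForm_apply]

theorem third_fderiv_swap (hc : ContDiffAt ℝ 4 c y) (a b d : E n × E n) :
    fderiv ℝ (fderiv ℝ (fderiv ℝ c)) y a b d = fderiv ℝ (fderiv ℝ (fderiv ℝ c)) y b a d := by
  have h : IsSymmSndFDerivAt ℝ (fderiv ℝ c) y :=
    (hc.fderiv_right (m := 3) (by norm_num)).isSymmSndFDerivAt (by simp; norm_num)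
  rw [h a b]

theorem third_fderiv_swap_right (hc : ContDiffAt ℝ 4 c y) (a b d : E n × E n) :
    fderiv ℝ (fderiv ℝ (fderiv ℝ c)) y a b d = fderiv ℝ (fderiv ℝ (fderiv ℝ c)) y a d b := by
  have h := ((contDiffAt_hessian hc).differentiableAt (by norm_num)).hasFDerivAt
  have h1 := (h.clm_apply (hasFDerivAt_const b y)).clm_apply (hasFDerivAt_const d y)
  have h2 := (h.clm_apply (hasFDerivAt_const d y)).clm_apply (hasFDerivAt_const b y)
  -- the Hessian is symmetric at all nearby points, so its derivative is symmetric as well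
  have hev : (fun z => fderiv ℝ (fderiv ℝ c) z b d) =ᶠ[𝓝 y]
      fun z => fderiv ℝ (fderiv ℝ c) z d b := by
    filter_upwards [hc.eventually (by simp)] with z hz
    exact (hz.isSymmSndFDerivAt (by simp; norm_num)) b d
  have h3 := DFunLike.congr_fun ((h2.congr_of_eventuallyEq hev).unique h1) a
  simpa using h3.symm

/-- The metric is Kähler-like: derivatives along the first factor are symmetric in the arguments
from that factor. -/
theorem dCostForm_inl_swap (hc : ContDiffAt ℝ 4 c y) (u u' v : E n) :
    dCostForm c y (u, 0) u' v = dCostForm c y (u', 0) u v := by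
  simp only [dCostForm, crossForm_apply]
  rw [third_fderiv_swap hc]

/-- Derivatives along the second factor are symmetric in the arguments from that factor. -/
theorem dCostForm_inr_swap (hc : ContDiffAt ℝ 4 c y) (u v v' : E n) :
    dCostForm c y (0, v) u v' = dCostForm c y (0, v') u v := by
  simp only [dCostForm, crossForm_apply]
  rw [third_fderiv_swap hc, third_fderiv_swap_right hc, third_fderiv_swap hc]

theorem dCostForm_add (a a' : E n × E n) (u v : E n) :
    dCostForm c y (a + a') u v = dCostForm c y a u v + dCostForm c y a' u v := by
  simp [dCostForm, crossForm_apply]; ring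

theorem dCostForm_split (a : E n × E n) (u v : E n) :
    dCostForm c y a u v = dCostForm c y (a.1, 0) u v + dCostForm c y (0, a.2) u v := by
  rw [← dCostForm_add]; simp

variable {f : E n → E n × E n} {x₀ : E n}

/-- The derivative along `f` of the metric paired with two coordinate fields `∂_v f`, `∂_w f`. -/
theorem hasFDerivAt_costForm_comp (hf : ContDiffAt ℝ 2 f x₀) (hc : ContDiffAt ℝ 4 c (f x₀))
    (v w : E n) :
    ∃ D : E n →L[ℝ] ℝ,
      HasFDerivAt (fun x => costForm c (f x) (fderiv ℝ f x v).1 (fderiv ℝ f x w).2) D x₀ ∧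
      ∀ z, D z = dCostForm c (f x₀) (fderiv ℝ f x₀ z) (fderiv ℝ f x₀ v).1 (fderiv ℝ f x₀ w).2 +
        costForm c (f x₀) (fderiv ℝ (fderiv ℝ f) x₀ z v).1 (fderiv ℝ f x₀ w).2 +
        costForm c (f x₀) (fderiv ℝ f x₀ v).1 (fderiv ℝ (fderiv ℝ f) x₀ z w).2 := by
  have h := ((contDiffAt_hessian hc).differentiableAt (by norm_num)).hasFDerivAt.comp x₀
    (hf.differentiableAt (by norm_num)).hasFDerivAt
  have hD := ((hf.fderiv_right (m := 1) (by norm_num)).differentiableAt (by norm_num)).hasFDerivAt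
  have hv := ((ContinuousLinearMap.inl ℝ (E n) (E n) ∘L
    ContinuousLinearMap.fst ℝ (E n) (E n)).hasFDerivAt.comp x₀
      (hD.clm_apply (hasFDerivAt_const v x₀)))
  have hw := ((ContinuousLinearMap.inr ℝ (E n) (E n) ∘L
    ContinuousLinearMap.snd ℝ (E n) (E n)).hasFDerivAt.comp x₀
      (hD.clm_apply (hasFDerivAt_const w x₀)))
  refine ⟨_, ((h.clm_apply hv).clm_apply hw).const_mul (-(1 / 2)), fun z => ?_⟩
  simp [dCostForm, costForm, crossForm_apply]
  ring

end Coordinates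

/-! ### The angle in coordinates -/

section AngleCoordinates

variable {n : ℕ} {c : E n × E n → ℝ} {f : E n → E n × E n} {x₀ : E n}

/-- The Gram matrix of the induced metric of a Lagrangian immersion `f` in coordinates. It is
written as `2 b(∂ᵢ f, ∂ⱼ f)`, which is the induced metric only because `f` is Lagrangian. -/
def gramMatrix (c : E n × E n → ℝ) (f : E n → E n × E n) (x : E n) : Matrix (Fin n) (Fin n) ℝ :=
  Matrix.of fun i j => ((2 : ℝ) • costForm c (f x)) (fderiv ℝ f x (EuclideanSpace.single i 1)).1
    (fderiv ℝ f x (EuclideanSpace.single j 1)).2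

/-- The matrix of the `M`-component of the differential of `f`. -/
def fstMatrix (f : E n → E n × E n) (x : E n) : Matrix (Fin n) (Fin n) ℝ :=
  colMatrix fun i => (fderiv ℝ f x (EuclideanSpace.single i 1)).1

/-- The matrix of the `N`-component of the differential of `f`. -/
def sndMatrix (f : E n → E n × E n) (x : E n) : Matrix (Fin n) (Fin n) ℝ :=
  colMatrix fun i => (fderiv ℝ f x (EuclideanSpace.single i 1)).2

theorem contDiffAt_det {V : Type*} [NormedAddCommGroup V] [NormedSpace ℝ V]
    {A : V → Matrix (Fin n) (Fin n) ℝ} {x : V} {k : WithTop ℕ∞}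
    (hA : ∀ i j, ContDiffAt ℝ k (fun y => A y i j) x) :
    ContDiffAt ℝ k (fun y => (A y).det) x := by
  simp only [Matrix.det_apply']
  exact ContDiffAt.sum fun σ _ => contDiffAt_const.mul (contDiffAt_prod fun i _ => hA _ _)

theorem contDiffAt_fstMatrix (hf : ContDiffAt ℝ 2 f x₀) (i j : Fin n) :
    ContDiffAt ℝ 1 (fun x => fstMatrix f x i j) x₀ :=
  ((EuclideanSpace.proj i ∘L ContinuousLinearMap.fst ℝ (E n) (E n)).contDiff.contDiffAt).comp x₀
    ((hf.fderiv_right (m := 1) (by norm_num)).clm_apply contDiffAt_const)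

theorem contDiffAt_sndMatrix (hf : ContDiffAt ℝ 2 f x₀) (i j : Fin n) :
    ContDiffAt ℝ 1 (fun x => sndMatrix f x i j) x₀ :=
  ((EuclideanSpace.proj i ∘L ContinuousLinearMap.snd ℝ (E n) (E n)).contDiff.contDiffAt).comp x₀
    ((hf.fderiv_right (m := 1) (by norm_num)).clm_apply contDiffAt_const)

theorem hasFDerivAt_log_det_fstMatrix (hf : ContDiffAt ℝ 2 f x₀) (hA : (fstMatrix f x₀).det ≠ 0) :
    ∃ D : E n →L[ℝ] ℝ, HasFDerivAt (fun x => Real.log (fstMatrix f x).det) D x₀ ∧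
      ∀ w, D w = ((fstMatrix f x₀)⁻¹ * colMatrix fun i =>
        (fderiv ℝ (fderiv ℝ f) x₀ w (EuclideanSpace.single i 1)).1).trace := by
  have hD := ((hf.fderiv_right (m := 1) (by norm_num)).differentiableAt (by norm_num)).hasFDerivAt
  obtain ⟨D, h, h'⟩ := hasFDerivAt_log_det (A := fstMatrix f) (fun i j =>
    ((EuclideanSpace.proj i ∘L ContinuousLinearMap.fst ℝ (E n) (E n)).hasFDerivAt.comp x₀
      (hD.clm_apply (hasFDerivAt_const (EuclideanSpace.single j 1) x₀)))) hA
  refine ⟨D, h, fun w => (h' w).trans ?_⟩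
  congr 2
  ext i j
  simp [colMatrix]

theorem hasFDerivAt_log_det_sndMatrix (hf : ContDiffAt ℝ 2 f x₀) (hA : (sndMatrix f x₀).det ≠ 0) :
    ∃ D : E n →L[ℝ] ℝ, HasFDerivAt (fun x => Real.log (sndMatrix f x).det) D x₀ ∧
      ∀ w, D w = ((sndMatrix f x₀)⁻¹ * colMatrix fun i =>
        (fderiv ℝ (fderiv ℝ f) x₀ w (EuclideanSpace.single i 1)).2).trace := by
  have hD := ((hf.fderiv_right (m := 1) (by norm_num)).differentiableAt (by norm_num)).hasFDerivAt
  obtain ⟨D, h, h'⟩ := hasFDerivAt_log_det (A := sndMatrix f) (fun i j =>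
    ((EuclideanSpace.proj i ∘L ContinuousLinearMap.snd ℝ (E n) (E n)).hasFDerivAt.comp x₀
      (hD.clm_apply (hasFDerivAt_const (EuclideanSpace.single j 1) x₀)))) hA
  refine ⟨D, h, fun w => (h' w).trans ?_⟩
  congr 2
  ext i j
  simp [colMatrix]

theorem hasFDerivAt_log_det_costForm {y : E n × E n} (hc : ContDiffAt ℝ 4 c y)
    (hC : (formMatrix ((2 : ℝ) • costForm c y)).det ≠ 0) :
    ∃ D : E n × E n →L[ℝ] ℝ,
      HasFDerivAt (fun y => Real.log (formMatrix ((2 : ℝ) • costForm c y)).det) D y ∧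
      ∀ a, D a = ((formMatrix ((2 : ℝ) • costForm c y))⁻¹ *
        formMatrix ((2 : ℝ) • dCostForm c y a)).trace := by
  choose B' hB hB' using fun u v => hasFDerivAt_costForm hc u v
  obtain ⟨D, h, h'⟩ := hasFDerivAt_log_det
    (A := fun y => formMatrix ((2 : ℝ) • costForm c y))
    (fun i j => (hB (EuclideanSpace.single i 1) (EuclideanSpace.single j 1)).const_mul 2) hC
  refine ⟨D, h, fun w => (h' w).trans ?_⟩
  congr 2
  ext i j
  simp [formMatrix, hB']

/-- The coefficient of `g^{ij}` in the mean curvature form evaluated at `w`, written through the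
second derivatives of `f` and the derivatives of the metric. -/
def curvatureTerm (c : E n × E n → ℝ) (f : E n → E n × E n) (x : E n) (u v w : E n) : ℝ :=
  costForm c (f x) (fderiv ℝ (fderiv ℝ f) x u v).1 (fderiv ℝ f x w).2 +
    dCostForm c (f x) ((fderiv ℝ f x u).1, 0) (fderiv ℝ f x v).1 (fderiv ℝ f x w).2 -
    costForm c (f x) (fderiv ℝ f x w).1 (fderiv ℝ (fderiv ℝ f) x u v).2 -
    dCostForm c (f x) (0, (fderiv ℝ f x u).2) (fderiv ℝ f x w).1 (fderiv ℝ f x v).2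

/-- The derivative of the Lagrangian condition `b(∂_w f, ∂_v f) = b(∂_v f, ∂_w f)` in the
direction `u`. -/
theorem lagrangian_fderiv (hf : ContDiffAt ℝ 2 f x₀) (hc : ContDiffAt ℝ 4 c (f x₀))
    (hlag : ∀ᶠ x in 𝓝 x₀, ∀ v w, costForm c (f x) (fderiv ℝ f x v).1 (fderiv ℝ f x w).2 =
      costForm c (f x) (fderiv ℝ f x w).1 (fderiv ℝ f x v).2) (u v w : E n) :
    costForm c (f x₀) (fderiv ℝ (fderiv ℝ f) x₀ w u).1 (fderiv ℝ f x₀ v).2 -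
      costForm c (f x₀) (fderiv ℝ f x₀ v).1 (fderiv ℝ (fderiv ℝ f) x₀ w u).2 =
    curvatureTerm c f x₀ u v w +
      dCostForm c (f x₀) (0, (fderiv ℝ f x₀ w).2) (fderiv ℝ f x₀ v).1 (fderiv ℝ f x₀ u).2 -
      dCostForm c (f x₀) ((fderiv ℝ f x₀ w).1, 0) (fderiv ℝ f x₀ u).1 (fderiv ℝ f x₀ v).2 := by
  obtain ⟨D₁, h₁, h₁'⟩ := hasFDerivAt_costForm_comp hf hc w v
  obtain ⟨D₂, h₂, h₂'⟩ := hasFDerivAt_costForm_comp hf hc v w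
  have hev : (fun x => costForm c (f x) (fderiv ℝ f x w).1 (fderiv ℝ f x v).2) =ᶠ[𝓝 x₀]
      fun x => costForm c (f x) (fderiv ℝ f x v).1 (fderiv ℝ f x w).2 :=
    hlag.mono fun x hx => hx w v
  have hDD := DFunLike.congr_fun ((h₂.congr_of_eventuallyEq hev).unique h₁) u
  rw [h₁', h₂', dCostForm_split, dCostForm_split (fderiv ℝ f x₀ u)] at hDD
  have hsymm : IsSymmSndFDerivAt ℝ f x₀ := hf.isSymmSndFDerivAt (by simp)
  rw [hsymm w u]
  simp only [curvatureTerm]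
  rw [dCostForm_inr_swap hc _ (fderiv ℝ f x₀ w).2, dCostForm_inl_swap hc (fderiv ℝ f x₀ w).1]
  linarith

variable {ρ ρ' ψ : E n × E n → ℝ} {θ : E n → ℝ}

/-- The formula `dθ(w) = α_H(w) + n dψ(K ∂_w f)` in coordinates. It follows from
`2 θ = log (ρ det A) - log (ρ' det A')`, where `A`, `A'` are the two components of the differential
of `f`, from `2 n ψ = log (ρ ρ') - log det (2 b)`, where `b = costForm c`, and from Jacobi's
formula. -/
theorem fderiv_angle (hn : n ≠ 0) (hf : ContDiffAt ℝ 2 f x₀) (hc : ContDiffAt ℝ 4 c (f x₀))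
    (hlag : ∀ᶠ x in 𝓝 x₀, ∀ v w, costForm c (f x) (fderiv ℝ f x v).1 (fderiv ℝ f x w).2 =
      costForm c (f x) (fderiv ℝ f x w).1 (fderiv ℝ f x v).2)
    (hG : (gramMatrix c f x₀).det ≠ 0)
    (hρ : ContDiffAt ℝ 1 ρ (f x₀)) (hρ' : ContDiffAt ℝ 1 ρ' (f x₀))
    (hρ0 : ∀ w, fderiv ℝ ρ (f x₀) (0, w) = 0) (hρ0' : ∀ w, fderiv ℝ ρ' (f x₀) (w, 0) = 0)
    (hψ : ∀ᶠ y in 𝓝 (f x₀), Real.exp (2 * n * ψ y) *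
      (formMatrix ((2 : ℝ) • costForm c y)).det = ρ y * ρ' y)
    (hθ : ∀ᶠ x in 𝓝 x₀, Real.exp (2 * θ x) * (ρ' (f x) * (sndMatrix f x).det) =
      ρ (f x) * (fstMatrix f x).det) :
    ContDiffAt ℝ 1 θ x₀ ∧ DifferentiableAt ℝ ψ (f x₀) ∧ ∀ w, fderiv ℝ θ x₀ w =
      ∑ i, ∑ j, (gramMatrix c f x₀)⁻¹ i j *
        curvatureTerm c f x₀ (EuclideanSpace.single i 1) (EuclideanSpace.single j 1) w +
      n * fderiv ℝ ψ (f x₀) ((fderiv ℝ f x₀ w).1, -(fderiv ℝ f x₀ w).2) := by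
  have hn' : (n : ℝ) ≠ 0 := Nat.cast_ne_zero.2 hn
  obtain ⟨hA, hC, hA'⟩ : (fstMatrix f x₀).det ≠ 0 ∧
      (formMatrix ((2 : ℝ) • costForm c (f x₀))).det ≠ 0 ∧ (sndMatrix f x₀).det ≠ 0 :=
    det_ne_zero_of_gram hG
  have hρρ : ρ (f x₀) * ρ' (f x₀) ≠ 0 := by
    rw [← hψ.self_of_nhds]
    exact mul_ne_zero (Real.exp_ne_zero _) hC
  have hr := left_ne_zero_of_mul hρρ
  have hr' := right_ne_zero_of_mul hρρ
  have cA := contDiffAt_det fun i j => contDiffAt_fstMatrix hf i j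
  have cA' := contDiffAt_det fun i j => contDiffAt_sndMatrix hf i j
  have hf1 : ContDiffAt ℝ 1 f x₀ := hf.of_le (by norm_num)
  have cρ := hρ.comp x₀ hf1
  have cρ' := hρ'.comp x₀ hf1
  -- the individual factors may be negative: `Real.log` is the logarithm of the absolute value, so
  -- it turns products of nonzero numbers into sums regardless of the signs
  have hθ' : θ =ᶠ[𝓝 x₀] fun x => (1 / 2) * (Real.log (ρ (f x)) + Real.log (fstMatrix f x).det -
      Real.log (ρ' (f x)) - Real.log (sndMatrix f x).det) := by
    filter_upwards [hθ, cA.continuousAt.eventually_ne hA, cA'.continuousAt.eventually_ne hA',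
      cρ.continuousAt.eventually_ne hr, cρ'.continuousAt.eventually_ne hr'] with x h h1 h2 h3 h4
    have h5 := congrArg Real.log h
    simp only [Function.comp_apply] at h3 h4
    rw [Real.log_mul (Real.exp_ne_zero _) (mul_ne_zero h4 h2), Real.log_mul h4 h2,
      Real.log_mul h3 h1, Real.log_exp] at h5
    linarith
  obtain ⟨DA, hDA, hDA'⟩ := hasFDerivAt_log_det_fstMatrix hf hA
  obtain ⟨DB, hDB, hDB'⟩ := hasFDerivAt_log_det_sndMatrix hf hA'
  obtain ⟨DC, hDC, hDC'⟩ := hasFDerivAt_log_det_costForm hc hC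
  have hcC : ContinuousAt (fun y => (formMatrix ((2 : ℝ) • costForm c y)).det) (f x₀) := by
    choose B' hB hB' using fun u v => hasFDerivAt_costForm hc u v
    exact (hasFDerivAt_det (A := fun y => formMatrix ((2 : ℝ) • costForm c y)) (fun i j =>
      (hB (EuclideanSpace.single i 1) (EuclideanSpace.single j 1)).const_mul 2)).continuousAt
  have hψ' : ψ =ᶠ[𝓝 (f x₀)] fun y => (1 / (2 * n)) * (Real.log (ρ y) + Real.log (ρ' y) -
      Real.log (formMatrix ((2 : ℝ) • costForm c y)).det) := by
    filter_upwards [hψ, hcC.eventually_ne hC, hρ.continuousAt.eventually_ne hr,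
      hρ'.continuousAt.eventually_ne hr'] with y h h1 h2 h3
    have h5 := congrArg Real.log h
    rw [Real.log_mul (Real.exp_ne_zero _) h1, Real.log_mul h2 h3, Real.log_exp] at h5
    rw [← h5]
    field_simp
    ring
  have dρ := (hρ.differentiableAt (by norm_num)).hasFDerivAt.log hr
  have dρ' := (hρ'.differentiableAt (by norm_num)).hasFDerivAt.log hr'
  have df := (hf1.differentiableAt (by norm_num)).hasFDerivAt
  have dψ := (((dρ.add dρ').sub hDC).const_mul (1 / (2 * n : ℝ))).congr_of_eventuallyEq hψ'
  have dθ := (((((dρ.comp x₀ df).add hDA).sub (dρ'.comp x₀ df)).sub hDB).const_mul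
    (1 / 2)).congr_of_eventuallyEq hθ'
  refine ⟨?_, dψ.differentiableAt, fun w => ?_⟩
  · refine ContDiffAt.congr_of_eventuallyEq ?_ hθ'
    exact contDiffAt_const.mul ((((cρ.log hr).add (cA.log hA)).sub (cρ'.log hr')).sub (cA'.log hA'))
  rw [dθ.fderiv, dψ.fderiv]
  set a := fderiv ℝ f x₀ w with ha
  -- by the Cauchy-Riemann equations `ρ` sees only the first component and `ρ'` only the second
  have e1 : fderiv ℝ ρ (f x₀) a = fderiv ℝ ρ (f x₀) (a.1, -a.2) := by
    rw [← sub_eq_zero, ← map_sub]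
    convert! hρ0 (a.2 + a.2) using 2
    ext <;> simp
  have e2 : fderiv ℝ ρ' (f x₀) a = -fderiv ℝ ρ' (f x₀) (a.1, -a.2) := by
    rw [← sub_eq_zero, sub_neg_eq_add, ← map_add]
    convert! hρ0' (a.1 + a.1) using 2
    ext <;> simp
  have e3 : DC (a.1, -a.2) = DC (a.1, 0) - DC (0, a.2) := by
    rw [← map_sub]
    simp
  have hs : ∀ i j, ((2 : ℝ) • costForm c (f x₀)) (fderiv ℝ f x₀ (EuclideanSpace.single i 1)).1
      (fderiv ℝ f x₀ (EuclideanSpace.single j 1)).2 = ((2 : ℝ) • costForm c (f x₀))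
      (fderiv ℝ f x₀ (EuclideanSpace.single j 1)).1
      (fderiv ℝ f x₀ (EuclideanSpace.single i 1)).2 := fun i j => by
    simp only [LinearMap.smul_apply, hlag.self_of_nhds]
  -- the four logarithmic derivatives as traces with respect to the induced metric; the index order
  -- in `t3` and `t4` is chosen such that the summands of `key` agree term by term
  have t1 : DA w = ∑ i, ∑ j, (gramMatrix c f x₀)⁻¹ i j * _ :=
    (hDA' w).trans (trace_inv_mul_left hG hs _)
  have t2 : DB w = ∑ i, ∑ j, (gramMatrix c f x₀)⁻¹ i j * _ :=
    (hDB' w).trans (trace_inv_mul_right hG _)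
  have t3 : DC (a.1, 0) = ∑ i, ∑ j, (gramMatrix c f x₀)⁻¹ i j * _ :=
    (hDC' _).trans (trace_inv_mul_form' hG hs _)
  have t4 : DC (0, a.2) = ∑ i, ∑ j, (gramMatrix c f x₀)⁻¹ i j * _ :=
    (hDC' _).trans (trace_inv_mul_form hG _)
  have key : DA w - DB w + (DC (a.1, 0) - DC (0, a.2)) = 2 * ∑ i, ∑ j, (gramMatrix c f x₀)⁻¹ i j *
        curvatureTerm c f x₀ (EuclideanSpace.single i 1) (EuclideanSpace.single j 1) w := by
    rw [t1, t2, t3, t4]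
    simp only [← Finset.sum_sub_distrib, ← Finset.sum_add_distrib, Finset.mul_sum]
    refine Finset.sum_congr rfl fun i _ => Finset.sum_congr rfl fun j _ => ?_
    have := lagrangian_fderiv hf hc hlag (EuclideanSpace.single i 1) (EuclideanSpace.single j 1) w
    simp only [LinearMap.smul_apply, smul_eq_mul]
    linear_combination 2 * (gramMatrix c f x₀)⁻¹ i j * this
  simp only [ContinuousLinearMap.comp_apply, smul_apply, add_apply, sub_apply, smul_eq_mul, ← ha]
  rw [e1, e2, e3]
  field_simp
  linear_combination (ρ (f x₀) * ρ' (f x₀)) * key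

end AngleCoordinates

/-! ### Pointwise algebra -/

section Musical

variable {V : Type*} [AddCommGroup V] [Module ℝ V] [FiniteDimensional ℝ V]

/-- For a nondegenerate form and a linear functional, `sharp` takes its intended value. -/
theorem sharp_spec {B : LinearMap.BilinForm ℝ V} (hB : ∀ v, (∀ w, B v w = 0) → v = 0)
    {φ : V → ℝ} (φ' : V →ₗ[ℝ] ℝ) (hφ : ∀ w, φ w = φ' w) (w : V) : B (sharp B φ) w = φ w := by
  have hinj : Function.Injective (B : V →ₗ[ℝ] Module.Dual ℝ V) := by
    refine (injective_iff_map_eq_zero _).2 fun v hv => hB v fun w => ?_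
    rw [hv]; rfl
  obtain ⟨v, hv⟩ := (LinearMap.injective_iff_surjective_of_finrank_eq_finrank
    (Subspace.dual_finrank_eq (K := ℝ) (V := V)).symm).1 hinj φ'
  have hex : ∃ v, ∀ w, B v w = φ w := ⟨v, fun w => by rw [hφ, hv]⟩
  exact Classical.epsilon_spec hex w

end Musical

section Pointwise

variable {n : ℕ}
  {M : Type*} [TopologicalSpace M] [ChartedSpace (E n) M]
  {N : Type*} [TopologicalSpace N] [ChartedSpace (E n) N]
  {L : Type*} [TopologicalSpace L] [ChartedSpace (E n) L]

instance (z : M × N) : FiniteDimensional ℝ (Tan n z) :=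
  inferInstanceAs (FiniteDimensional ℝ (E n × E n))

instance (p : L) : FiniteDimensional ℝ (TangentSpace (𝓡 n) p) :=
  inferInstanceAs (FiniteDimensional ℝ (E n))

/-- The component of an ambient vector tangent to `M`. -/
def tanFst (z : M × N) : Tan n z →ₗ[ℝ] TangentSpace (𝓡 n) z.1 := LinearMap.fst ℝ (E n) (E n)

/-- The component of an ambient vector tangent to `N`. -/
def tanSnd (z : M × N) : Tan n z →ₗ[ℝ] TangentSpace (𝓡 n) z.2 := LinearMap.snd ℝ (E n) (E n)

theorem inl_add_inr (z : M × N) (V : Tan n z) : inl z (tanFst z V) + inr z (tanSnd z V) = V :=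
  Prod.fst_add_snd (show E n × E n from V)

theorem K_eq (z : M × N) (V : Tan n z) : K z V = inl z (tanFst z V) - inr z (tanSnd z V) := by
  refine Prod.ext (?_ : (V.1 : E n) = V.1 - 0) (?_ : (-V.2 : E n) = 0 - V.2) <;> simp

theorem K_K (z : M × N) (V : Tan n z) : K z (K z V) = V :=
  Prod.ext rfl (neg_neg (show E n × E n from V).2)

/-! ### The metric and the para-complex structure -/

variable (X : KMStructure n M N) {z : M × N}

theorem KMStructure.h_apply (hz : z ∉ X.cutLocus) (V W : Tan n z) :
    X.h z V W = X.h z (inl z (tanFst z V)) (inr z (tanSnd z W)) +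
      X.h z (inl z (tanFst z W)) (inr z (tanSnd z V)) := by
  conv_lhs => rw [← inl_add_inr z V, ← inl_add_inr z W]
  simp only [map_add, LinearMap.add_apply, X.inl_inl z hz, X.inr_inr z hz]
  rw [X.symm z hz (inr z _)]
  ring

theorem KMStructure.omega_apply (hz : z ∉ X.cutLocus) (V W : Tan n z) :
    X.omega z V W = X.h z (inl z (tanFst z V)) (inr z (tanSnd z W)) -
      X.h z (inl z (tanFst z W)) (inr z (tanSnd z V)) := by
  rw [KMStructure.omega, K_eq]
  conv_lhs => rw [← inl_add_inr z W]
  simp only [map_add, map_sub, LinearMap.sub_apply, X.inl_inl z hz, X.inr_inr z hz]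
  rw [X.symm z hz (inr z _)]
  ring

/-- `K` is an anti-isometry of `h`. -/
theorem KMStructure.h_K (hz : z ∉ X.cutLocus) (V W : Tan n z) :
    X.h z V (K z W) = -X.h z (K z V) W := by
  rw [X.symm z hz V]
  change X.omega z W V = - X.omega z V W
  rw [X.omega_apply hz, X.omega_apply hz]
  ring

theorem KMStructure.omega_eq_neg (hz : z ∉ X.cutLocus) (V W : Tan n z) :
    X.omega z V W = -X.h z V (K z W) := by
  rw [X.h_K hz, neg_neg]; rfl

/-! ### Forms of type `(n, 0)` -/

/-- The `τ`-part as a linear map. -/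
def tauLin : ParaComplex →ₗ[ℝ] ℝ where
  toFun := tauPart
  map_add' x y := by simp [tauPart]; ring
  map_smul' r x := by simp [tauPart]; ring

/-- The `τ'`-part as a linear map. -/
def tauBarLin : ParaComplex →ₗ[ℝ] ℝ where
  toFun := tauBarPart
  map_add' x y := by simp [tauBarPart]; ring
  map_smul' r x := by simp [tauBarPart]; ring

theorem tauPart_kUnit_mul (x : ParaComplex) : tauPart (kUnit * x) = tauPart x := by
  simp [tauPart, kUnit]; ring

theorem tauBarPart_kUnit_mul (x : ParaComplex) : tauBarPart (kUnit * x) = -tauBarPart x := by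
  simp [tauBarPart, kUnit]

theorem paraComplex_ext {x y : ParaComplex} (h : tauPart x = tauPart y)
    (h' : tauBarPart x = tauBarPart y) : x = y := by
  simp only [tauPart, tauBarPart] at h h'
  exact QuadraticAlgebra.ext (by linarith) (by linarith)

/-- If replacing any one argument by its image under `P` does not change `φ`, then neither does
replacing all of them. -/
theorem alternatingMap_map_eq {T : Type*} [AddCommGroup T] [Module ℝ T] (φ : T [⋀^Fin n]→ₗ[ℝ] ℝ)
    (P : T → T) (hP : ∀ V i, φ (Function.update V i (P (V i))) = φ V) (V : Fin n → T) :
    φ (fun i => P (V i)) = φ V := by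
  have key : ∀ s : Finset (Fin n), φ (s.piecewise (fun i => P (V i)) V) = φ V := by
    intro s
    induction s using Finset.induction_on with
    | empty => simp
    | insert a s ha ih =>
      rw [Finset.piecewise_insert, ← ih, ← hP (s.piecewise (fun i => P (V i)) V) a,
        Finset.piecewise_eq_of_notMem _ _ _ ha]
  simpa using key Finset.univ

/-- The `τ`-part of an `(n, 0)`-form only depends on the components tangent to `M`. -/
theorem IsTypeN0.tauPart_inl {Ω : ParaForm n M N} (hΩ : IsTypeN0 Ω) (z : M × N)
    (V : Fin n → Tan n z) :
    tauPart (Ω z fun i => inl z (tanFst z (V i))) = tauPart (Ω z V) := by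
  refine alternatingMap_map_eq (tauLin.compAlternatingMap (Ω z)) (fun W => inl z (tanFst z W))
    (fun V i => ?_) V
  have h1 : inl z (tanFst z (V i)) = (1 / 2 : ℝ) • (V i + K z (V i)) := by
    refine Prod.ext (?_ : (V i).1 = (1 / 2 : ℝ) • ((V i).1 + (V i).1))
      (?_ : (0 : E n) = (1 / 2 : ℝ) • ((V i).2 + -(V i).2))
    · rw [← two_smul ℝ, smul_smul]; norm_num
    · simp
  rw [h1, AlternatingMap.map_update_smul, AlternatingMap.map_update_add, Function.update_eq_self]
  have h2 : tauLin.compAlternatingMap (Ω z) (Function.update V i (K z (V i))) =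
      tauLin.compAlternatingMap (Ω z) V := by
    simp only [LinearMap.compAlternatingMap_apply, hΩ z V i]
    exact tauPart_kUnit_mul _
  rw [h2, smul_eq_mul]
  ring

/-- The `τ'`-part of an `(n, 0)`-form only depends on the components tangent to `N`. -/
theorem IsTypeN0.tauBarPart_inr {Ω : ParaForm n M N} (hΩ : IsTypeN0 Ω) (z : M × N)
    (V : Fin n → Tan n z) :
    tauBarPart (Ω z fun i => inr z (tanSnd z (V i))) = tauBarPart (Ω z V) := by
  refine alternatingMap_map_eq (tauBarLin.compAlternatingMap (Ω z)) (fun W => inr z (tanSnd z W))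
    (fun V i => ?_) V
  have h1 : inr z (tanSnd z (V i)) = (1 / 2 : ℝ) • (V i + (-1 : ℝ) • K z (V i)) := by
    refine Prod.ext (?_ : (0 : E n) = (1 / 2 : ℝ) • ((V i).1 + (-1 : ℝ) • (V i).1))
      (?_ : (V i).2 = (1 / 2 : ℝ) • ((V i).2 + (-1 : ℝ) • -(V i).2))
    · simp
    · rw [neg_one_smul, neg_neg, ← two_smul ℝ, smul_smul]; norm_num
  rw [h1, AlternatingMap.map_update_smul, AlternatingMap.map_update_add, Function.update_eq_self,
    AlternatingMap.map_update_smul]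
  have h2 : tauBarLin.compAlternatingMap (Ω z) (Function.update V i (K z (V i))) =
      -tauBarLin.compAlternatingMap (Ω z) V := by
    simp only [LinearMap.compAlternatingMap_apply, hΩ z V i]
    exact tauBarPart_kUnit_mul _
  rw [h2, smul_eq_mul, smul_eq_mul]
  ring

theorem alternatingMap_eq_det_mul {T : Type*} [AddCommGroup T] [Module ℝ T]
    (φ : T [⋀^Fin n]→ₗ[ℝ] ℝ) (ℓ : E n →ₗ[ℝ] T) (a : Fin n → E n) :
    φ (fun i => ℓ (a i)) =
      (colMatrix a).det * φ (fun i => ℓ (EuclideanSpace.single i 1)) := by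
  have h := DFunLike.congr_fun ((φ.compLinearMap ℓ).eq_smul_basis_det
    (EuclideanSpace.basisFun (Fin n) ℝ).toBasis) a
  rw [AlternatingMap.smul_apply, Module.Basis.det_apply] at h
  have h2 : (EuclideanSpace.basisFun (Fin n) ℝ).toBasis.toMatrix a = colMatrix a := by
    ext i j
    simp [Module.Basis.toMatrix_apply, colMatrix]
  rw [h2, smul_eq_mul, mul_comm] at h
  simpa using h

/-! ### The Lagrangian angle -/

variable {X : GKMStructure n M N} {ψ : M × N → ℝ} {F : L → M × N}

/-- The Lagrangian condition, as the symmetry of the mixed part of `h` along `L`. -/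
theorem KMStructure.IsSpacelikeLagrangian.cross_symm {X : KMStructure n M N}
    (hF : X.IsSpacelikeLagrangian F) (p : L) (v w : TangentSpace (𝓡 n) p) :
    X.h (F p) (inl _ (tanFst _ (dF F p v))) (inr _ (tanSnd _ (dF F p w))) =
      X.h (F p) (inl _ (tanFst _ (dF F p w))) (inr _ (tanSnd _ (dF F p v))) := by
  have h := hF.lagrangian p v w
  rw [X.omega_apply (hF.notMem_cutLocus p)] at h
  linarith

theorem KMStructure.IsSpacelikeLagrangian.g_apply {X : KMStructure n M N}
    (hF : X.IsSpacelikeLagrangian F) (p : L) (v w : TangentSpace (𝓡 n) p) :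
    X.g F p v w =
      2 * X.h (F p) (inl _ (tanFst _ (dF F p v))) (inr _ (tanSnd _ (dF F p w))) := by
  rw [KMStructure.g, LinearMap.compl₁₂_apply, X.h_apply (hF.notMem_cutLocus p),
    hF.cross_symm p w v]
  ring

theorem KMStructure.IsSpacelikeLagrangian.det_g_pos {X : KMStructure n M N}
    (hF : X.IsSpacelikeLagrangian F) (p : L) :
    0 < (Matrix.of fun i j => X.g F p (coordVec p i) (coordVec p j)).det := by
  refine Matrix.PosDef.det_pos (Matrix.PosDef.of_dotProduct_mulVec_pos ?_ fun x hx => ?_)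
  · ext i j
    simp only [Matrix.conjTranspose_apply, Matrix.of_apply, star_trivial]
    rw [hF.g_apply, hF.g_apply, hF.cross_symm]
  · have hv : (∑ i, x i • coordVec p i : TangentSpace (𝓡 n) p) ≠ 0 := by
      intro h0
      apply hx
      have h1 : (WithLp.toLp 2 x : E n) = 0 := by
        rw [eq_sum_single (WithLp.toLp 2 x : E n)]
        exact h0
      funext i
      exact congrArg (fun y : E n => y i) h1
    have h := hF.spacelike p _ hv
    simp only [map_sum, map_smul, LinearMap.sum_apply, LinearMap.smul_apply, smul_eq_mul] at h
    refine h.trans_eq (Finset.sum_congr rfl fun i _ => congrArg (x i * ·)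
      (Finset.sum_congr rfl fun j _ => ?_))
    rw [mul_comm, hF.g_apply, hF.cross_symm, ← hF.g_apply]
    rfl

theorem GKMStructure.tauPart_mul_tauBarPart (hψ : X.IsPsi ψ) (hF : X.IsSpacelikeLagrangian F)
    (p : L) (v : Fin n → TangentSpace (𝓡 n) p) :
    tauPart (X.Omega (F p) fun i => dF F p (v i)) *
      tauBarPart (X.Omega (F p) fun i => dF F p (v i)) =
    Real.exp (2 * n * ψ (F p)) * (Matrix.of fun i j => X.g F p (v i) (v j)).det := by
  rw [← X.isParaHolomorphic.isTypeN0.tauPart_inl, ← X.isParaHolomorphic.isTypeN0.tauBarPart_inr]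
  rw [← hψ (F p) (hF.notMem_cutLocus p) (fun i => tanFst _ (dF F p (v i)))
    (fun i => tanSnd _ (dF F p (v i)))]
  simp only [hF.g_apply]

theorem tauPart_smul_expK (r t : ℝ) : tauPart (r • expK t) = r * Real.exp t := by
  simp only [tauPart, expK, QuadraticAlgebra.re_smul, QuadraticAlgebra.im_smul, smul_eq_mul,
    ← mul_add, Real.cosh_add_sinh]

theorem tauBarPart_smul_expK (r t : ℝ) : tauBarPart (r • expK t) = r * Real.exp (-t) := by
  simp only [tauBarPart, expK, QuadraticAlgebra.re_smul, QuadraticAlgebra.im_smul, smul_eq_mul,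
    ← mul_sub, Real.cosh_sub_sinh]

theorem GKMStructure.IsLagrangianAngle.exp_mul_tauBarPart {θ : L → ℝ}
    (h : X.IsLagrangianAngle ψ F θ) (p : L) (v : Fin n → TangentSpace (𝓡 n) p) :
    Real.exp (2 * θ p) * tauBarPart (X.Omega (F p) fun i => dF F p (v i)) =
      tauPart (X.Omega (F p) fun i => dF F p (v i)) := by
  rw [h p, tauPart_smul_expK, tauBarPart_smul_expK, two_mul, Real.exp_add, Real.exp_neg]
  field_simp [Real.exp_ne_zero]

/-- As both sides of the defining equation are alternating, `θ` is a Lagrangian angle if and only if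
`e^{2θ}` is the quotient of the `τ`-part and the `τ'`-part of `Ω` on one basis of each tangent
space. -/
theorem GKMStructure.isLagrangianAngle_iff (hψ : X.IsPsi ψ) (hF : X.IsSpacelikeLagrangian F)
    (θ : L → ℝ) : X.IsLagrangianAngle ψ F θ ↔ ∀ p,
      Real.exp (2 * θ p) * tauBarPart (X.Omega (F p) fun i => dF F p (coordVec p i)) =
        tauPart (X.Omega (F p) fun i => dF F p (coordVec p i)) := by
  refine ⟨fun h p => h.exp_mul_tauBarPart p _, fun h p v => ?_⟩
  have hu : tauPart (X.Omega (F p) fun i => dF F p (v i)) = (colMatrix (n := n) v).det *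
      tauPart (X.Omega (F p) fun i => dF F p (coordVec p i)) :=
    alternatingMap_eq_det_mul (tauLin.compAlternatingMap (X.Omega (F p))) (dF F p) v
  have hu' : tauBarPart (X.Omega (F p) fun i => dF F p (v i)) = (colMatrix (n := n) v).det *
      tauBarPart (X.Omega (F p) fun i => dF F p (coordVec p i)) :=
    alternatingMap_eq_det_mul (tauBarLin.compAlternatingMap (X.Omega (F p))) (dF F p) v
  have hprod := X.tauPart_mul_tauBarPart hψ hF p v
  have hrel : Real.exp (2 * θ p) * tauBarPart (X.Omega (F p) fun i => dF F p (v i)) =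
      tauPart (X.Omega (F p) fun i => dF F p (v i)) := by
    rw [hu, hu', ← h p]; ring
  clear hu hu'
  set u := tauPart (X.Omega (F p) fun i => dF F p (v i)) with hu
  set u' := tauBarPart (X.Omega (F p) fun i => dF F p (v i)) with hu'
  -- `u' = e^{-2θ} u`, so the Gram determinant is the square of `e^{-nψ} |u| e^{-θ}`
  have hdet : Real.sqrt (Matrix.of fun i j => X.g F p (v i) (v j)).det =
      Real.exp (-(n * ψ (F p))) * |u| * Real.exp (-θ p) := by
    rw [← Real.sqrt_sq (by positivity : 0 ≤ Real.exp (-(n * ψ (F p))) * |u| * Real.exp (-θ p))]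
    congr 1
    rw [mul_pow, mul_pow, sq_abs]
    have e1 : Real.exp (-(n * ψ (F p))) ^ 2 * Real.exp (2 * n * ψ (F p)) = 1 := by
      rw [pow_two, ← Real.exp_add, ← Real.exp_add, Real.exp_eq_one_iff]; ring
    have e2 : Real.exp (-θ p) ^ 2 * Real.exp (2 * θ p) = 1 := by
      rw [pow_two, ← Real.exp_add, ← Real.exp_add, Real.exp_eq_one_iff]; ring
    set d := (Matrix.of fun i j => X.g F p (v i) (v j)).det
    linear_combination (-d) * e1 + Real.exp (-(n * ψ (F p))) ^ 2 * Real.exp (-θ p) ^ 2 * u * hrel -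
      Real.exp (-(n * ψ (F p))) ^ 2 * u * u' * e2 - Real.exp (-(n * ψ (F p))) ^ 2 * hprod
  have hr : Real.exp (n * ψ (F p)) * X.dVol F p v = u * Real.exp (-θ p) := by
    rw [GKMStructure.dVol, hdet, ← hu]
    have h1 : Real.exp (n * ψ (F p)) * Real.exp (-(n * ψ (F p))) = 1 := by
      rw [← Real.exp_add]; simp
    have h2 : Real.sign u * |u| = u := by
      rcases lt_trichotomy u 0 with h | h | h
      · rw [Real.sign_of_neg h, abs_of_neg h]; ring
      · simp [h]
      · rw [Real.sign_of_pos h, abs_of_pos h]; ring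
    linear_combination (Real.sign u * |u| * Real.exp (-θ p)) * h1 + Real.exp (-θ p) * h2
  rw [hr]
  refine paraComplex_ext ?_ ?_
  · rw [tauPart_smul_expK, ← hu, mul_assoc, ← Real.exp_add]; simp
  · rw [tauBarPart_smul_expK, ← hu', ← hrel, two_mul, Real.exp_add, Real.exp_neg]
    field_simp [Real.exp_ne_zero]

theorem GKMStructure.existsUnique_lagrangianAngle (hψ : X.IsPsi ψ)
    (hF : X.IsSpacelikeLagrangian F) : ∃! θ : L → ℝ, X.IsLagrangianAngle ψ F θ := by
  have hpos : ∀ p, 0 < tauPart (X.Omega (F p) fun i => dF F p (coordVec p i)) *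
      tauBarPart (X.Omega (F p) fun i => dF F p (coordVec p i)) := fun p => by
    rw [X.tauPart_mul_tauBarPart hψ hF]
    exact mul_pos (Real.exp_pos _) (hF.det_g_pos p)
  simp only [X.isLagrangianAngle_iff hψ hF]
  have hne := fun p => right_ne_zero_of_mul (hpos p).ne'
  refine ⟨fun p => Real.log (tauPart (X.Omega (F p) fun i => dF F p (coordVec p i)) /
    tauBarPart (X.Omega (F p) fun i => dF F p (coordVec p i))) / 2, fun p => ?_,
    fun θ hθ => funext fun p => ?_⟩
  · rw [mul_div_cancel₀ _ two_ne_zero, Real.exp_log, div_mul_cancel₀ _ (hne p)]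
    exact div_pos_iff.2 (pos_and_pos_or_neg_and_neg_of_mul_pos (hpos p))
  · rw [← hθ p, mul_div_cancel_right₀ _ (hne p), Real.log_exp]
    ring

end Pointwise

/-! ### Differentials in charts -/

section Charts

variable {V : Type*} [NormedAddCommGroup V] [NormedSpace ℝ V] {H : Type*} [TopologicalSpace H]
  {I : ModelWithCorners ℝ V H} [I.Boundaryless] {M : Type*} [TopologicalSpace M] [ChartedSpace H M]
  [IsManifold I ∞ M]
  {W : Type*} [NormedAddCommGroup W] [NormedSpace ℝ W]

theorem mdifferentiableAt_extChartAt_symm {z₀ : M} {y : V} (hy : y ∈ (extChartAt I z₀).target) :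
    MDifferentiableAt 𝓘(ℝ, V) I (extChartAt I z₀).symm y := by
  have : IsManifold I 1 M := IsManifold.of_le (n := ∞) (by simp)
  have h := mdifferentiableWithinAt_extChartAt_symm (I := I) (x := z₀) hy
  rwa [I.range_eq_univ, mdifferentiableWithinAt_univ] at h

theorem mfderiv_extChartAt_symm_self (z₀ : M) (a : V) :
    (mfderiv 𝓘(ℝ, V) I (extChartAt I z₀).symm (extChartAt I z₀ z₀) a : V) = a := by
  have : IsManifold I 1 M := IsManifold.of_le (n := ∞) (by simp)
  have h := mfderivWithin_range_extChartAt_symm (I := I) (x := z₀)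
  rw [I.range_eq_univ, mfderivWithin_univ] at h
  exact DFunLike.congr_fun h a

/-- A function on a manifold whose coordinate expression is differentiable is differentiable, and
its differential is computed in coordinates. -/
theorem mfderiv_of_chart {z₀ : M} {y : V} (hy : y ∈ (extChartAt I z₀).target) {g : M → W}
    {Ψ : V → W} (hg : g ∘ (extChartAt I z₀).symm =ᶠ[𝓝 y] Ψ) (hΨ : DifferentiableAt ℝ Ψ y) (a : V) :
    mfderiv I 𝓘(ℝ, W) g ((extChartAt I z₀).symm y)
      (mfderiv 𝓘(ℝ, V) I (extChartAt I z₀).symm y a) = fderiv ℝ Ψ y a := by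
  have : IsManifold I 1 M := IsManifold.of_le (n := ∞) (by simp)
  have hs : (extChartAt I z₀).symm y ∈ (extChartAt I z₀).source := (extChartAt I z₀).map_target hy
  have hχ := continuousAt_extChartAt' (I := I) hs
  have hev : g =ᶠ[𝓝 ((extChartAt I z₀).symm y)] Ψ ∘ extChartAt I z₀ := by
    rw [ContinuousAt, (extChartAt I z₀).right_inv hy] at hχ
    filter_upwards [hχ.eventually hg, extChartAt_source_mem_nhds' (I := I) hs] with z h1 h2
    rw [Function.comp_apply, ← h1, Function.comp_apply, (extChartAt I z₀).left_inv h2]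
  have hg' : MDifferentiableAt I 𝓘(ℝ, W) g ((extChartAt I z₀).symm y) := by
    refine MDifferentiableAt.congr_of_eventuallyEq ?_ hev
    refine MDifferentiableAt.comp (I' := 𝓘(ℝ, V)) _ ?_
      (mdifferentiableAt_extChartAt (by simpa using hs))
    rw [(extChartAt I z₀).right_inv hy]
    exact hΨ.mdifferentiableAt
  have h1 := mfderiv_comp_apply y hg' (mdifferentiableAt_extChartAt_symm hy) a
  rw [← h1, hg.mfderiv_eq, mfderiv_eq_fderiv]
  rfl

theorem mfderiv_of_chart_self {z₀ : M} {g : M → W} {Ψ : V → W}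
    (hg : g ∘ (extChartAt I z₀).symm =ᶠ[𝓝 (extChartAt I z₀ z₀)] Ψ)
    (hΨ : DifferentiableAt ℝ Ψ (extChartAt I z₀ z₀)) (a : TangentSpace I z₀) :
    mfderiv I 𝓘(ℝ, W) g z₀ a = fderiv ℝ Ψ (extChartAt I z₀ z₀) a := by
  have e : ∀ z, z = z₀ → ∀ b : V, b = a →
      (mfderiv I 𝓘(ℝ, W) g z₀ a : W) = mfderiv I 𝓘(ℝ, W) g z b := by
    rintro _ rfl _ rfl
    rfl
  exact (e _ (extChartAt_to_inv z₀) _ (mfderiv_extChartAt_symm_self (V := V) z₀ a)).trans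
    (mfderiv_of_chart (V := V) (mem_extChartAt_target z₀) hg hΨ a)

end Charts

section ProductChart

variable {n : ℕ}
  {M : Type*} [TopologicalSpace M] [ChartedSpace (E n) M]
  {N : Type*} [TopologicalSpace N] [ChartedSpace (E n) N]

theorem unchart_eq (z₀ : M × N) (y : E n × E n) :
    unchart n z₀ y = ((extChartAt (𝓡 n) z₀.1).symm y.1, (extChartAt (𝓡 n) z₀.2).symm y.2) := by
  rw [unchart, extChartAt_prod]; rfl

theorem mem_target_prod {z₀ : M × N} {y : E n × E n} :
    y ∈ (extChartAt (prodModel n) z₀).target ↔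
      y.1 ∈ (extChartAt (𝓡 n) z₀.1).target ∧ y.2 ∈ (extChartAt (𝓡 n) z₀.2).target := by
  rw [extChartAt_prod]; rfl

variable [IsManifold (𝓡 n) ∞ M] [IsManifold (𝓡 n) ∞ N]

theorem dUnchart_apply {z₀ : M × N} {y : E n × E n}
    (hy : y ∈ (extChartAt (prodModel n) z₀).target) (a : E n × E n) :
    (dUnchart z₀ y a : E n × E n) =
      ((mfderiv 𝓘(ℝ, E n) (𝓡 n) (extChartAt (𝓡 n) z₀.1).symm y.1 a.1 : E n),
       (mfderiv 𝓘(ℝ, E n) (𝓡 n) (extChartAt (𝓡 n) z₀.2).symm y.2 a.2 : E n)) := by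
  obtain ⟨h1, h2⟩ := mem_target_prod.1 hy
  have d1 := mdifferentiableAt_extChartAt_symm h1
  have d2 := mdifferentiableAt_extChartAt_symm h2
  have f1 : MDifferentiableAt 𝓘(ℝ, E n × E n) 𝓘(ℝ, E n) (Prod.fst : E n × E n → E n) y :=
    differentiableAt_fst.mdifferentiableAt
  have f2 : MDifferentiableAt 𝓘(ℝ, E n × E n) 𝓘(ℝ, E n) (Prod.snd : E n × E n → E n) y :=
    differentiableAt_snd.mdifferentiableAt
  have h := (d1.comp y f1).mfderiv_prod (d2.comp y f2)
  have hu : unchart n z₀ = fun y => (((extChartAt (𝓡 n) z₀.1).symm ∘ Prod.fst) y,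
      ((extChartAt (𝓡 n) z₀.2).symm ∘ Prod.snd) y) :=
    funext fun y => unchart_eq z₀ y
  have e : (dUnchart z₀ y a : E n × E n) =
      ((mfderiv 𝓘(ℝ, E n × E n) (𝓡 n) ((extChartAt (𝓡 n) z₀.1).symm ∘ Prod.fst) y a : E n),
        (mfderiv 𝓘(ℝ, E n × E n) (𝓡 n) ((extChartAt (𝓡 n) z₀.2).symm ∘ Prod.snd) y a : E n)) := by
    rw [dUnchart, hu]
    exact DFunLike.congr_fun h a
  have g1 := mfderiv_comp_apply y d1 f1 a
  have g2 := mfderiv_comp_apply y d2 f2 a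
  rw [mfderiv_eq_fderiv, fderiv_fst] at g1
  rw [mfderiv_eq_fderiv, fderiv_snd] at g2
  exact e.trans (Prod.ext g1 g2)

theorem dUnchart_self (z₀ : M × N) (a : E n × E n) :
    (dUnchart z₀ (extChartAt (prodModel n) z₀ z₀) a : E n × E n) = a :=
  mfderiv_extChartAt_symm_self (I := prodModel n) z₀ a

/-- The mixed second derivative of `c` is the mixed second derivative of its coordinate
expression. -/
theorem mixedDeriv_unchart {z₀ : M × N} {y : E n × E n}
    (hy : y ∈ (extChartAt (prodModel n) z₀).target) {c : M × N → ℝ}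
    (hc : ContDiffAt ℝ 4 (c ∘ unchart n z₀) y) (u v : E n) :
    mixedDeriv c (unchart n z₀ y)
      (tanFst _ (dUnchart z₀ y (u, 0))) (tanSnd _ (dUnchart z₀ y (0, v))) =
    fderiv ℝ (fderiv ℝ (c ∘ unchart n z₀)) y (u, 0) (0, v) := by
  obtain ⟨h1, h2⟩ := mem_target_prod.1 hy
  set s₁ := (extChartAt (𝓡 n) z₀.1).symm with hs₁
  set s₂ := (extChartAt (𝓡 n) z₀.2).symm with hs₂
  -- the base points agree, but not definitionally, so the equation is transported
  have e : ∀ z', z' = (s₁ y.1, s₂ y.2) → ∀ v' w' v'' w'' : E n, v' = v'' → w' = w'' →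
      mixedDeriv c z' v' w' = mixedDeriv c (s₁ y.1, s₂ y.2) v'' w'' := by
    rintro _ rfl v' w' _ _ rfl rfl
    rfl
  refine (e _ (unchart_eq z₀ y) _ _ _ _ (congrArg Prod.fst (dUnchart_apply hy (u, 0)))
    (congrArg Prod.snd (dUnchart_apply hy (0, v)))).trans ?_
  set c' := c ∘ unchart n z₀ with hc'
  have hcs : ∀ r s, c (s₁ r, s₂ s) = c' (r, s) := fun r s => by
    rw [hc', Function.comp_apply, unchart_eq]
  have hd : ∀ᶠ r in 𝓝 y.1, ContDiffAt ℝ 4 c' (r, y.2) :=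
    (by fun_prop : ContinuousAt (fun r : E n => (r, y.2)) y.1).eventually
      (hc.eventually (by simp))
  have h3 := ((hc.fderiv_right (m := 3) (by norm_num)).differentiableAt (by norm_num)).hasFDerivAt
  have hΨ : HasFDerivAt (fun r : E n => fderiv ℝ c' (r, y.2) (0, v))
      (((ContinuousLinearMap.apply ℝ ℝ ((0, v) : E n × E n)) ∘L
        fderiv ℝ (fderiv ℝ c') y) ∘L ContinuousLinearMap.inl ℝ (E n) (E n)) y.1 :=
    ((ContinuousLinearMap.apply ℝ ℝ ((0, v) : E n × E n)).hasFDerivAt.comp y h3).comp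
      (f := fun r : E n => (r, y.2)) y.1 (hasFDerivAt_prodMk_left y.1 y.2)
  have hφ : (fun x : M => (mfderiv (𝓡 n) 𝓘(ℝ, ℝ) (fun t : N => c (x, t)) (s₂ y.2)
      (mfderiv 𝓘(ℝ, E n) (𝓡 n) s₂ y.2 v) : ℝ)) ∘ s₁ =ᶠ[𝓝 y.1]
      fun r => fderiv ℝ c' (r, y.2) (0, v) := by
    filter_upwards [hd] with r hr
    have h4 : HasFDerivAt (fun s : E n => c' (r, s))
        (fderiv ℝ c' (r, y.2) ∘L ContinuousLinearMap.inr ℝ (E n) (E n)) y.2 :=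
      ((hr.differentiableAt (by norm_num)).hasFDerivAt).comp
        (f := fun s : E n => (r, s)) y.2 (hasFDerivAt_prodMk_right r y.2)
    have h5 := mfderiv_of_chart (g := fun t : N => c (s₁ r, t)) h2
      (Filter.Eventually.of_forall fun s => hcs r s) h4.differentiableAt v
    rw [h4.fderiv] at h5
    exact h5
  have h6 := mfderiv_of_chart h1 hφ hΨ.differentiableAt u
  rw [hΨ.fderiv] at h6
  exact h6

end ProductChart

/-! ### Local costs and Christoffel symbols -/

section LocalCost

variable {n : ℕ}
  {M : Type*} [TopologicalSpace M] [ChartedSpace (E n) M]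
  {N : Type*} [TopologicalSpace N] [ChartedSpace (E n) N]

/-- `dUnchart` as a linear map. -/
def dUnchartLin (z₀ : M × N) (y : E n × E n) : (E n × E n) →ₗ[ℝ] Tan n (unchart n z₀ y) :=
  (mfderiv 𝓘(ℝ, E n × E n) (prodModel n) (unchart n z₀) y).toLinearMap

/-- `c` is the expression in the chart at `z₀` of a cost function which induces the metric near
`z₀`. -/
structure KMStructure.IsLocalCost (X : KMStructure n M N) (z₀ : M × N) (c : E n × E n → ℝ) :
    Prop where
  contDiffAt : ContDiffAt ℝ 4 c (extChartAt (prodModel n) z₀ z₀)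
  eventually : ∀ᶠ y in 𝓝 (extChartAt (prodModel n) z₀ z₀),
    y ∈ (extChartAt (prodModel n) z₀).target ∧ unchart n z₀ y ∉ X.cutLocus ∧
    ∀ a b : E n × E n, X.h (unchart n z₀ y) (inl _ (tanFst _ (dUnchart z₀ y a)))
      (inr _ (tanSnd _ (dUnchart z₀ y b))) = costForm c y a.1 b.2

variable {X : KMStructure n M N} {z₀ : M × N} {c : E n × E n → ℝ}

theorem KMStructure.IsLocalCost.hChart_eventuallyEq (hc : X.IsLocalCost z₀ c) (a b : E n × E n) :
    (fun y => X.hChart z₀ y a b) =ᶠ[𝓝 (extChartAt (prodModel n) z₀ z₀)]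
      fun y => costForm c y a.1 b.2 + costForm c y b.1 a.2 := by
  filter_upwards [hc.eventually] with y ⟨h1, h2, h3⟩
  rw [KMStructure.hChart, X.h_apply h2, h3, h3]

theorem KMStructure.IsLocalCost.dh_eq (hc : X.IsLocalCost z₀ c) (a b d : E n × E n) :
    X.dh z₀ a b d = dCostForm c (extChartAt (prodModel n) z₀ z₀) a b.1 d.2 +
      dCostForm c (extChartAt (prodModel n) z₀ z₀) a d.1 b.2 := by
  obtain ⟨D₁, h₁, h₁'⟩ := hasFDerivAt_costForm hc.contDiffAt b.1 d.2
  obtain ⟨D₂, h₂, h₂'⟩ := hasFDerivAt_costForm hc.contDiffAt d.1 b.2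
  rw [KMStructure.dh, ((h₁.add h₂).congr_of_eventuallyEq (hc.hChart_eventuallyEq b d)).fderiv,
    add_apply, h₁', h₂']

/-- The Koszul formula, with the derivatives of the metric in coordinates. -/
theorem KMStructure.IsLocalCost.h_christoffel (hc : X.IsLocalCost z₀ c) (hz : z₀ ∉ X.cutLocus)
    (a b d : Tan n z₀) :
    X.h z₀ (X.christoffel z₀ a b) d = (X.dh z₀ a b d + X.dh z₀ b a d - X.dh z₀ d a b) / 2 := by
  let y₀ := extChartAt (prodModel n) z₀ z₀
  -- the Koszul expression is linear in `d`, so that `sharp` is not a junk value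
  have hlin : ∀ a b : E n × E n, ∃ φ : E n × E n →ₗ[ℝ] ℝ, ∀ d, X.dh z₀ a b d = φ d := by
    intro a b
    refine ⟨(dCostForm c y₀ a b.1).comp (LinearMap.snd ℝ (E n) (E n)) +
      ((dCostForm c y₀ a).flip b.2).comp (LinearMap.fst ℝ (E n) (E n)), fun d => ?_⟩
    rw [hc.dh_eq]
    rfl
  have hlin' : ∀ a b : E n × E n, ∃ φ : E n × E n →ₗ[ℝ] ℝ, ∀ d, X.dh z₀ d a b = φ d := by
    intro a b
    refine ⟨IsLinearMap.mk' (fun d => X.dh z₀ d a b) ⟨fun d d' => ?_, fun r d => ?_⟩, fun d => rfl⟩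
    · simp only [hc.dh_eq, dCostForm_add]
      ring
    · simp only [hc.dh_eq, dCostForm, crossForm_apply, map_smul, smul_apply, smul_eq_mul]
      ring
  obtain ⟨φ₁, h₁⟩ := hlin a b
  obtain ⟨φ₂, h₂⟩ := hlin b a
  obtain ⟨φ₃, h₃⟩ := hlin' a b
  refine sharp_spec (X.nondegenerate z₀ hz) ((1 / 2 : ℝ) • (φ₁ + φ₂ - φ₃) : E n × E n →ₗ[ℝ] ℝ)
    (fun d => ?_) d
  change _ = (1 / 2 : ℝ) * (φ₁ d + φ₂ d - φ₃ d)
  have e₁ := h₁ d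
  have e₂ := h₂ d
  have e₃ := h₃ d
  linarith

variable [IsManifold (𝓡 n) ∞ M] [IsManifold (𝓡 n) ∞ N]

theorem inl_tanFst_dUnchart {z₀ : M × N} {y : E n × E n}
    (hy : y ∈ (extChartAt (prodModel n) z₀).target) (a : E n × E n) :
    inl _ (tanFst _ (dUnchart z₀ y a)) = dUnchart z₀ y (a.1, 0) := by
  refine Prod.ext ?_ ?_
  · exact (congrArg Prod.fst (dUnchart_apply hy a)).trans
      (congrArg Prod.fst (dUnchart_apply hy (a.1, 0))).symm
  · refine Eq.trans ?_ (congrArg Prod.snd (dUnchart_apply hy (a.1, 0))).symm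
    exact (map_zero (mfderiv 𝓘(ℝ, E n) (𝓡 n) (extChartAt (𝓡 n) z₀.2).symm y.2)).symm

theorem inr_tanSnd_dUnchart {z₀ : M × N} {y : E n × E n}
    (hy : y ∈ (extChartAt (prodModel n) z₀).target) (a : E n × E n) :
    inr _ (tanSnd _ (dUnchart z₀ y a)) = dUnchart z₀ y (0, a.2) := by
  refine Prod.ext ?_ ?_
  · refine Eq.trans ?_ (congrArg Prod.fst (dUnchart_apply hy (0, a.2))).symm
    exact (map_zero (mfderiv 𝓘(ℝ, E n) (𝓡 n) (extChartAt (𝓡 n) z₀.1).symm y.1)).symm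
  · exact (congrArg Prod.snd (dUnchart_apply hy a)).trans
      (congrArg Prod.snd (dUnchart_apply hy (0, a.2))).symm

theorem KMStructure.exists_isLocalCost (X : KMStructure n M N) {z₀ : M × N}
    (hz : z₀ ∉ X.cutLocus) : ∃ c, X.IsLocalCost z₀ c := by
  obtain ⟨c, hc, hh⟩ := X.exists_cost z₀ hz
  have hc' : ContDiffAt ℝ 4 (c ∘ unchart n z₀) (extChartAt (prodModel n) z₀ z₀) := by
    have h := (contMDiffAt_iff.1 hc).2
    rw [ModelWithCorners.range_eq_univ, contDiffWithinAt_univ] at h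
    exact h
  have ht : Filter.Tendsto (unchart n z₀) (𝓝 (extChartAt (prodModel n) z₀ z₀)) (𝓝 z₀) := by
    have h := continuousAt_extChartAt_symm (I := prodModel n) z₀
    rwa [ContinuousAt, extChartAt_to_inv] at h
  refine ⟨c ∘ unchart n z₀, hc', ?_⟩
  filter_upwards [extChartAt_target_mem_nhds (I := prodModel n) z₀,
    ht.eventually (X.isClosed_cutLocus.isOpen_compl.eventually_mem hz), ht.eventually hh,
    hc'.eventually (by simp)] with y h1 h2 h3 h4
  refine ⟨h1, h2, fun a b => ?_⟩
  rw [inl_tanFst_dUnchart h1, inr_tanSnd_dUnchart h1, costForm, crossForm_apply,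
    ← mixedDeriv_unchart h1 h4, ← h3, inl_tanFst_dUnchart h1, inr_tanSnd_dUnchart h1]

theorem KMStructure.IsLocalCost.h_self (hc : X.IsLocalCost z₀ c) (a b : E n) :
    X.h z₀ (inl _ a) (inr _ b) = costForm c (extChartAt (prodModel n) z₀ z₀) a b := by
  obtain ⟨h1, -, h3⟩ := hc.eventually.self_of_nhds
  rw [← h3 (a, 0) (0, b)]
  have e : ∀ z, z = z₀ → ∀ a' b' : E n × E n, a' = (a, 0) → b' = (0, b) →
      X.h z₀ (inl _ a) (inr _ b) = X.h z (inl _ (tanFst _ a')) (inr _ (tanSnd _ b')) := by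
    rintro _ rfl _ _ rfl rfl
    rfl
  exact e _ (extChartAt_to_inv z₀) _ _ (dUnchart_self z₀ _) (dUnchart_self z₀ _)

theorem KMStructure.IsLocalCost.h_self_apply (hc : X.IsLocalCost z₀ c) (hz : z₀ ∉ X.cutLocus)
    (V W : Tan n z₀) : X.h z₀ V W =
      costForm c (extChartAt (prodModel n) z₀ z₀) V.1 W.2 +
        costForm c (extChartAt (prodModel n) z₀ z₀) W.1 V.2 := by
  rw [X.h_apply hz, ← hc.h_self, ← hc.h_self]
  rfl

end LocalCost

/-! ### Lagrangian immersions in charts -/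

section Immersion

variable {n : ℕ}
  {M : Type*} [TopologicalSpace M] [ChartedSpace (E n) M]
  {N : Type*} [TopologicalSpace N] [ChartedSpace (E n) N]
  {L : Type*} [TopologicalSpace L] [ChartedSpace (E n) L]

/-- The expression of `F` in the preferred charts at `p` and `F p`. -/
abbrev coordMap (F : L → M × N) (p : L) : E n → E n × E n :=
  writtenInExtChartAt (𝓡 n) (prodModel n) p F

variable {F : L → M × N}

theorem coordMap_self (F : L → M × N) (p : L) :
    coordMap F p (extChartAt (𝓡 n) p p) = extChartAt (prodModel n) (F p) (F p) := by
  simp only [coordMap, writtenInExtChartAt, Function.comp_apply, extChartAt_to_inv]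

theorem contDiffAt_coordMap (hF : ContMDiff (𝓡 n) (prodModel n) 2 F) (p : L) :
    ContDiffAt ℝ 2 (coordMap F p) (extChartAt (𝓡 n) p p) := by
  have h := (contMDiffAt_iff.1 (hF p)).2
  rw [ModelWithCorners.range_eq_univ, contDiffWithinAt_univ] at h
  exact h

theorem dF_self (hF : ContMDiff (𝓡 n) (prodModel n) 2 F) (p : L) (v : TangentSpace (𝓡 n) p) :
    (dF F p v : E n × E n) = fderiv ℝ (coordMap F p) (extChartAt (𝓡 n) p p) v := by
  have h := ((hF p).mdifferentiableAt (by norm_num)).mfderiv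
  rw [ModelWithCorners.range_eq_univ, fderivWithin_univ] at h
  exact DFunLike.congr_fun h v

variable [IsManifold (𝓡 n) ∞ M] [IsManifold (𝓡 n) ∞ N]

/-- The coefficient `ρ` of `Ω` in a chart: the second summand of `coeff` has no `τ`-part. -/
theorem tauPart_coeff (hn : n ≠ 0) {Ω : ParaForm n M N} (hΩ : IsTypeN0 Ω) {z₀ : M × N}
    {y : E n × E n} (hy : y ∈ (extChartAt (prodModel n) z₀).target) :
    tauPart (coeff Ω z₀ y) =
      tauPart (Ω _ fun i => dUnchart z₀ y (EuclideanSpace.single i 1, 0)) := by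
  have : Nonempty (Fin n) := ⟨⟨0, Nat.pos_of_ne_zero hn⟩⟩
  have h : tauPart (Ω _ fun i => dUnchart z₀ y (0, EuclideanSpace.single i 1)) = 0 := by
    rw [← hΩ.tauPart_inl]
    simp only [inl_tanFst_dUnchart hy]
    exact (congrArg (fun V => tauLin (Ω _ V)) (funext fun i => (dUnchartLin z₀ y).map_zero)).trans
      ((congrArg tauLin (Ω _).map_zero).trans tauLin.map_zero)
  exact (tauLin.map_add _ _).trans ((congrArg _ h).trans (add_zero _))

/-- The coefficient `ρ'` of `Ω` in a chart: the first summand of `coeff` has no `τ'`-part. -/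
theorem tauBarPart_coeff (hn : n ≠ 0) {Ω : ParaForm n M N} (hΩ : IsTypeN0 Ω) {z₀ : M × N}
    {y : E n × E n} (hy : y ∈ (extChartAt (prodModel n) z₀).target) :
    tauBarPart (coeff Ω z₀ y) =
      tauBarPart (Ω _ fun i => dUnchart z₀ y (0, EuclideanSpace.single i 1)) := by
  have : Nonempty (Fin n) := ⟨⟨0, Nat.pos_of_ne_zero hn⟩⟩
  have h : tauBarPart (Ω _ fun i => dUnchart z₀ y (EuclideanSpace.single i 1, 0)) = 0 := by
    rw [← hΩ.tauBarPart_inr]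
    simp only [inr_tanSnd_dUnchart hy]
    exact (congrArg (fun V => tauBarLin (Ω _ V))
      (funext fun i => (dUnchartLin z₀ y).map_zero)).trans
      ((congrArg tauBarLin (Ω _).map_zero).trans tauBarLin.map_zero)
  exact (tauBarLin.map_add _ _).trans ((congrArg (· + _) h).trans (zero_add _))

theorem tauPart_dUnchart (hn : n ≠ 0) {Ω : ParaForm n M N} (hΩ : IsTypeN0 Ω) {z₀ : M × N}
    {y : E n × E n} (hy : y ∈ (extChartAt (prodModel n) z₀).target) (a : Fin n → E n × E n) :
    tauPart (Ω _ fun i => dUnchart z₀ y (a i)) =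
      tauPart (coeff Ω z₀ y) * (colMatrix fun i => (a i).1).det := by
  rw [tauPart_coeff hn hΩ hy, ← hΩ.tauPart_inl, mul_comm]
  simp only [inl_tanFst_dUnchart hy]
  exact alternatingMap_eq_det_mul (tauLin.compAlternatingMap (Ω _))
    (dUnchartLin z₀ y ∘ₗ LinearMap.inl ℝ (E n) (E n)) fun i => (a i).1

theorem tauBarPart_dUnchart (hn : n ≠ 0) {Ω : ParaForm n M N} (hΩ : IsTypeN0 Ω) {z₀ : M × N}
    {y : E n × E n} (hy : y ∈ (extChartAt (prodModel n) z₀).target) (a : Fin n → E n × E n) :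
    tauBarPart (Ω _ fun i => dUnchart z₀ y (a i)) =
      tauBarPart (coeff Ω z₀ y) * (colMatrix fun i => (a i).2).det := by
  rw [tauBarPart_coeff hn hΩ hy, ← hΩ.tauBarPart_inr, mul_comm]
  simp only [inr_tanSnd_dUnchart hy]
  exact alternatingMap_eq_det_mul (tauBarLin.compAlternatingMap (Ω _))
    (dUnchartLin z₀ y ∘ₗ LinearMap.inr ℝ (E n) (E n)) fun i => (a i).2

theorem gramMatrix_self {X : KMStructure n M N} (hF : X.IsSpacelikeLagrangian F) {p : L}
    {c : E n × E n → ℝ} (hc : X.IsLocalCost (F p) c) :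
    gramMatrix c (coordMap F p) (extChartAt (𝓡 n) p p) =
      Matrix.of fun i j => X.g F p (coordVec p i) (coordVec p j) := by
  ext i j
  rw [Matrix.of_apply, hF.g_apply]
  have h := hc.h_self (dF F p (coordVec p i)).1 (dF F p (coordVec p j)).2
  conv_rhs at h => rw [dF_self hF.contMDiff, dF_self hF.contMDiff, ← coordMap_self]
  exact (congrArg (2 * ·) h).symm

variable [IsManifold (𝓡 n) ∞ L]

/-- Near `p`, the differential of `F` in the charts at `p` and `F p`. -/
theorem dF_eventually (hF : ContMDiff (𝓡 n) (prodModel n) 2 F) (p : L) :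
    ∀ᶠ x in 𝓝 (extChartAt (𝓡 n) p p),
      F ((extChartAt (𝓡 n) p).symm x) = unchart n (F p) (coordMap F p x) ∧
      ∀ v : E n, (dF F ((extChartAt (𝓡 n) p).symm x)
        (mfderiv 𝓘(ℝ, E n) (𝓡 n) (extChartAt (𝓡 n) p).symm x v) : E n × E n) =
        dUnchart (F p) (coordMap F p x) (fderiv ℝ (coordMap F p) x v) := by
  have hf := contDiffAt_coordMap hF p
  have ht : Filter.Tendsto (F ∘ (extChartAt (𝓡 n) p).symm) (𝓝 (extChartAt (𝓡 n) p p))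
      (𝓝 (F p)) := by
    have h := continuousAt_extChartAt_symm (I := 𝓡 n) p
    rw [ContinuousAt, extChartAt_to_inv] at h
    exact hF.continuous.continuousAt.tendsto.comp h
  have hev : F ∘ (extChartAt (𝓡 n) p).symm =ᶠ[𝓝 (extChartAt (𝓡 n) p p)]
      unchart n (F p) ∘ coordMap F p := by
    filter_upwards [ht.eventually (extChartAt_source_mem_nhds (I := prodModel n) (F p))] with x hx
    exact ((extChartAt (prodModel n) (F p)).left_inv hx).symm
  have hy : ∀ᶠ x in 𝓝 (extChartAt (𝓡 n) p p),
      coordMap F p x ∈ (extChartAt (prodModel n) (F p)).target := by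
    refine hf.continuousAt.eventually_mem ?_
    rw [coordMap_self]
    exact extChartAt_target_mem_nhds (I := prodModel n) (F p)
  filter_upwards [hev.eventuallyEq_nhds, hy, extChartAt_target_mem_nhds (I := 𝓡 n) p,
    hf.eventually (by simp)] with x h1 h2 h3 h4
  refine ⟨h1.self_of_nhds, fun v => ?_⟩
  have d1 : MDifferentiableAt (𝓡 n) (prodModel n) F ((extChartAt (𝓡 n) p).symm x) :=
    (hF _).mdifferentiableAt (by norm_num)
  have d2 := mdifferentiableAt_extChartAt_symm h3
  have d3 : MDifferentiableAt 𝓘(ℝ, E n × E n) (prodModel n) (unchart n (F p)) (coordMap F p x) :=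
    mdifferentiableAt_extChartAt_symm h2
  have d4 : MDifferentiableAt 𝓘(ℝ, E n) 𝓘(ℝ, E n × E n) (coordMap F p) x :=
    (h4.differentiableAt (by norm_num)).mdifferentiableAt
  have e1 := mfderiv_comp_apply x d1 d2 v
  have e2 := mfderiv_comp_apply x d3 d4 v
  have e3 := DFunLike.congr_fun (h1.mfderiv_eq (I := 𝓘(ℝ, E n)) (I' := prodModel n)) v
  rw [mfderiv_eq_fderiv] at e2
  exact e1.symm.trans (e3.trans e2)

/-- The formula for `dθ` at a point of `L`, in the preferred charts. -/
theorem GKMStructure.fderiv_lagrangianAngle (hn : n ≠ 0) {X : GKMStructure n M N}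
    {ψ : M × N → ℝ} (hψ : X.IsPsi ψ) (hF : X.IsSpacelikeLagrangian F) {θ : L → ℝ}
    (hθ : X.IsLagrangianAngle ψ F θ) {p : L} {c : E n × E n → ℝ}
    (hc : X.IsLocalCost (F p) c) :
    ContDiffAt ℝ 1 (θ ∘ (extChartAt (𝓡 n) p).symm) (extChartAt (𝓡 n) p p) ∧
    DifferentiableAt ℝ (ψ ∘ unchart n (F p)) (extChartAt (prodModel n) (F p) (F p)) ∧
    ∀ w : E n, fderiv ℝ (θ ∘ (extChartAt (𝓡 n) p).symm) (extChartAt (𝓡 n) p p) w =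
      ∑ i, ∑ j, (Matrix.of fun i j => X.g F p (coordVec p i) (coordVec p j))⁻¹ i j *
        curvatureTerm c (coordMap F p) (extChartAt (𝓡 n) p p) (EuclideanSpace.single i 1)
          (EuclideanSpace.single j 1) w +
      n * fderiv ℝ (ψ ∘ unchart n (F p)) (extChartAt (prodModel n) (F p) (F p))
        ((fderiv ℝ (coordMap F p) (extChartAt (𝓡 n) p p) w).1,
          -(fderiv ℝ (coordMap F p) (extChartAt (𝓡 n) p p) w).2) := by
  have hΩ := X.isParaHolomorphic
  have hf := contDiffAt_coordMap hF.contMDiff p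
  have hmem := extChartAt_target_mem_nhds (I := prodModel n) (F p)
  have hdF := dF_eventually hF.contMDiff p
  have hcont : Filter.Tendsto (coordMap F p) (𝓝 (extChartAt (𝓡 n) p p))
      (𝓝 (extChartAt (prodModel n) (F p) (F p))) := by
    rw [← coordMap_self]; exact hf.continuousAt
  have hcev := hcont.eventually hc.eventually
  have hG : (gramMatrix c (coordMap F p) (extChartAt (𝓡 n) p p)).det ≠ 0 := by
    rw [gramMatrix_self hF hc]
    exact (hF.det_g_pos p).ne'
  rw [← gramMatrix_self hF hc, ← coordMap_self]
  refine fderiv_angle (ρ := fun y => tauPart (coeff X.Omega (F p) y))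
    (ρ' := fun y => tauBarPart (coeff X.Omega (F p) y)) hn hf ?_ ?_ hG ?_ ?_ ?_ ?_ ?_ ?_
  · rw [coordMap_self]
    exact hc.contDiffAt
  · filter_upwards [hcev, hdF] with x ⟨h1, h2, h3⟩ ⟨h4, h5⟩ v w
    have e : ∀ (z z' : M × N), z = z' → ∀ V V' W W' : E n × E n, V = V' → W = W' →
        X.h z (inl _ (tanFst z V)) (inr _ (tanSnd z W)) =
          X.h z' (inl _ (tanFst z' V')) (inr _ (tanSnd z' W')) := by
      rintro z _ rfl V _ W _ rfl rfl
      rfl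
    rw [← h3, ← h3]
    exact (e _ _ h4 _ _ _ _ (h5 v) (h5 w)).symm.trans ((hF.cross_symm _ _ _).trans
      (e _ _ h4 _ _ _ _ (h5 w) (h5 v)))
  · rw [coordMap_self]
    exact (hΩ.contDiffOn_u (F p)).contDiffAt hmem
  · rw [coordMap_self]
    exact (hΩ.contDiffOn_v (F p)).contDiffAt hmem
  · rw [coordMap_self]
    exact hΩ.cauchyRiemann_u (F p) _ (mem_extChartAt_target _)
  · rw [coordMap_self]
    exact hΩ.cauchyRiemann_v (F p) _ (mem_extChartAt_target _)
  · rw [coordMap_self]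
    filter_upwards [hc.eventually] with y ⟨h1, h2, h3⟩
    have h := hψ _ h2 (fun i => tanFst _ (dUnchart (F p) y (EuclideanSpace.single i 1, 0)))
      (fun i => tanSnd _ (dUnchart (F p) y (0, EuclideanSpace.single i 1)))
    simp only [h3] at h
    simp only [inl_tanFst_dUnchart h1, inr_tanSnd_dUnchart h1] at h
    rw [tauPart_coeff hn hΩ.isTypeN0 h1, tauBarPart_coeff hn hΩ.isTypeN0 h1]
    exact h
  · filter_upwards [hcev, hdF] with x ⟨h1, h2, h3⟩ ⟨h4, h5⟩
    have e : ∀ (z z' : M × N), z = z' → ∀ V V' : Fin n → E n × E n, V = V' →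
        X.Omega z V = X.Omega z' V' := by
      rintro z _ rfl V _ rfl
      rfl
    have h := hθ.exp_mul_tauBarPart ((extChartAt (𝓡 n) p).symm x) fun i =>
      mfderiv 𝓘(ℝ, E n) (𝓡 n) (extChartAt (𝓡 n) p).symm x (EuclideanSpace.single i 1)
    have h6 := e _ _ h4 _ _ (funext fun i => h5 (EuclideanSpace.single i 1))
    have h7 := tauPart_dUnchart hn hΩ.isTypeN0 h1
      fun i => fderiv ℝ (coordMap F p) x (EuclideanSpace.single i 1)
    have h8 := tauBarPart_dUnchart hn hΩ.isTypeN0 h1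
      fun i => fderiv ℝ (coordMap F p) x (EuclideanSpace.single i 1)
    have h9 := (congrArg tauPart h6).trans h7
    have h10 := (congrArg tauBarPart h6).trans h8
    exact ((congrArg (Real.exp (2 * θ ((extChartAt (𝓡 n) p).symm x)) * ·) h10).symm.trans h).trans
      h9

end Immersion

/-! ### The mean curvature form -/

section MeanCurvature

variable {n : ℕ}
  {M : Type*} [TopologicalSpace M] [ChartedSpace (E n) M]
  {N : Type*} [TopologicalSpace N] [ChartedSpace (E n) N]
  {L : Type*} [TopologicalSpace L] [ChartedSpace (E n) L]
  {F : L → M × N}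

/-- The Koszul expression for `h(Γ(a, b), K d)`: the symmetries of the third derivatives of the cost
cancel all but two terms. -/
theorem koszul_paraComplex {c : E n × E n → ℝ} {y : E n × E n} (hc : ContDiffAt ℝ 4 c y)
    (a b d : E n × E n) :
    ((dCostForm c y a b.1 (-d.2) + dCostForm c y a d.1 b.2) +
      (dCostForm c y b a.1 (-d.2) + dCostForm c y b d.1 a.2) -
      (dCostForm c y (d.1, -d.2) a.1 b.2 + dCostForm c y (d.1, -d.2) b.1 a.2)) / 2 =
    -dCostForm c y (a.1, 0) b.1 d.2 + dCostForm c y (0, a.2) d.1 b.2 := by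
  have hneg : ∀ u v, dCostForm c y (d.1, -d.2) u v =
      dCostForm c y (d.1, 0) u v - dCostForm c y (0, d.2) u v := fun u v => by
    rw [eq_sub_iff_add_eq, ← dCostForm_add]
    simp
  rw [hneg, hneg, map_neg, map_neg]
  simp only [dCostForm_split a, dCostForm_split b]
  linear_combination (-(1 / 2) : ℝ) * (dCostForm_inl_swap hc b.1 a.1 d.2) -
    (1 / 2) * dCostForm_inl_swap hc d.1 a.1 b.2 - (1 / 2) * dCostForm_inl_swap hc d.1 b.1 a.2 +
    (1 / 2) * dCostForm_inr_swap hc a.1 d.2 b.2 + (1 / 2) * dCostForm_inr_swap hc b.1 d.2 a.2 +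
    (1 / 2) * dCostForm_inr_swap hc d.1 b.2 a.2

variable {X : KMStructure n M N}

theorem KMStructure.IsSpacelikeLagrangian.h_dF_K_dF (hF : X.IsSpacelikeLagrangian F) (p : L)
    (v w : TangentSpace (𝓡 n) p) : X.h (F p) (dF F p v) (K (F p) (dF F p w)) = 0 := by
  rw [← neg_eq_zero, ← X.omega_eq_neg (hF.notMem_cutLocus p), hF.lagrangian]

theorem KMStructure.IsSpacelikeLagrangian.h_normalPart (hF : X.IsSpacelikeLagrangian F) (p : L)
    (V : Tan n (F p)) (w : TangentSpace (𝓡 n) p) :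
    X.h (F p) (X.normalPart F p V) (K (F p) (dF F p w)) = X.h (F p) V (K (F p) (dF F p w)) := by
  rw [KMStructure.normalPart, map_sub, LinearMap.sub_apply, hF.h_dF_K_dF, sub_zero]

theorem KMStructure.IsSpacelikeLagrangian.g_nondegenerate (hF : X.IsSpacelikeLagrangian F) (p : L)
    (v : TangentSpace (𝓡 n) p) (hv : ∀ w, X.g F p v w = 0) : v = 0 := by
  by_contra h
  exact (hF.spacelike p v h).ne' (hv v)

theorem KMStructure.IsSpacelikeLagrangian.h_normalPart_dF (hF : X.IsSpacelikeLagrangian F) (p : L)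
    (V : Tan n (F p)) (w : TangentSpace (𝓡 n) p) :
    X.h (F p) (X.normalPart F p V) (dF F p w) = 0 := by
  have h := sharp_spec (hF.g_nondegenerate p) (φ := fun w => X.h (F p) V (dF F p w))
    ((X.h (F p) V).comp (dF F p)) (fun _ => rfl) w
  rw [KMStructure.normalPart, map_sub, LinearMap.sub_apply, sub_eq_zero]
  exact h.symm

theorem surjective_of_ker_eq_zero {φ : E n →ₗ[ℝ] E n} (h : ∀ v, φ v = 0 → v = 0) :
    Function.Surjective φ :=
  LinearMap.injective_iff_surjective.1 ((injective_iff_map_eq_zero φ).2 h)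

/-- `dF (T L)` and `K dF (T L)` span the ambient tangent space. -/
theorem KMStructure.IsSpacelikeLagrangian.eq_zero_of_h_eq_zero (hF : X.IsSpacelikeLagrangian F)
    (p : L) {V : Tan n (F p)} (h₁ : ∀ w, X.h (F p) V (dF F p w) = 0)
    (h₂ : ∀ w, X.h (F p) V (K (F p) (dF F p w)) = 0) : V = 0 := by
  have hsplit : ∀ w : TangentSpace (𝓡 n) p, X.h (F p) V (inl _ (tanFst _ (dF F p w))) = 0 ∧
      X.h (F p) V (inr _ (tanSnd _ (dF F p w))) = 0 := by
    intro w
    have e₁ := h₁ w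
    have e₂ := h₂ w
    rw [K_eq, map_sub] at e₂
    rw [← inl_add_inr (F p) (dF F p w), map_add] at e₁
    constructor <;> linarith
  have hfst : Function.Surjective fun v => tanFst (n := n) (F p) (dF F p v) := by
    have h : ∀ v : TangentSpace (𝓡 n) p, tanFst (n := n) (F p) (dF F p v) = 0 → v = 0 := by
      intro v hv
      by_contra hne
      refine (hF.spacelike p v hne).ne' ?_
      rw [hF.g_apply, hv, show inl (F p) (0 : TangentSpace (𝓡 n) (F p).1) = 0 from rfl,
        map_zero,
      LinearMap.zero_apply, mul_zero]
    exact surjective_of_ker_eq_zero (φ := tanFst (n := n) (F p) ∘ₗ dF F p) h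
  have hsnd : Function.Surjective fun v => tanSnd (n := n) (F p) (dF F p v) := by
    have h : ∀ v : TangentSpace (𝓡 n) p, tanSnd (n := n) (F p) (dF F p v) = 0 → v = 0 := by
      intro v hv
      by_contra hne
      refine (hF.spacelike p v hne).ne' ?_
      rw [hF.g_apply, hv, show inr (F p) (0 : TangentSpace (𝓡 n) (F p).2) = 0 from rfl,
        map_zero, mul_zero]
    exact surjective_of_ker_eq_zero (φ := tanSnd (n := n) (F p) ∘ₗ dF F p) h
  refine X.nondegenerate _ (hF.notMem_cutLocus p) _ fun W => ?_
  obtain ⟨v, hv⟩ := hfst (tanFst _ W)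
  obtain ⟨w, hw⟩ := hsnd (tanSnd _ W)
  rw [← inl_add_inr (F p) W, map_add, ← hv, ← hw]
  exact (congrArg₂ (· + ·) (hsplit v).1 (hsplit w).2).trans (add_zero 0)

theorem KMStructure.h_grad {f : M × N → ℝ} {z : M × N} (hz : z ∉ X.cutLocus) (W : Tan n z) :
    X.h z (X.grad f z) W = mfderiv (prodModel n) 𝓘(ℝ, ℝ) f z W :=
  sharp_spec (X.nondegenerate z hz)
    (mfderiv (prodModel n) 𝓘(ℝ, ℝ) f z).toLinearMap (fun _ => rfl) W

/-- A tangent vector `t` with `g(t, ·) = ω(V, ·)` for a normal vector `V` satisfies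
`dF t = K V`. -/
theorem KMStructure.IsSpacelikeLagrangian.dF_eq_K (hF : X.IsSpacelikeLagrangian F) (p : L)
    {V : Tan n (F p)} (hV : ∀ w, X.h (F p) V (dF F p w) = 0) {t : TangentSpace (𝓡 n) p}
    (ht : ∀ w, X.g F p t w = X.omega (F p) V (dF F p w)) : dF F p t = K (F p) V := by
  rw [← sub_eq_zero]
  refine hF.eq_zero_of_h_eq_zero p (fun w => ?_) (fun w => ?_)
  · rw [map_sub, LinearMap.sub_apply, sub_eq_zero]
    exact ht w
  · rw [map_sub, LinearMap.sub_apply, hF.h_dF_K_dF, X.h_K (hF.notMem_cutLocus p), K_K, hV]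
    ring

theorem KMStructure.IsSpacelikeLagrangian.h_genMeanCurvature_dF (hF : X.IsSpacelikeLagrangian F)
    (ψ : M × N → ℝ) (p : L) (w : TangentSpace (𝓡 n) p) :
    X.h (F p) (X.genMeanCurvature ψ F p) (dF F p w) = 0 := by
  simp only [KMStructure.genMeanCurvature, KMStructure.meanCurvature, map_sub, map_sum, map_smul,
    LinearMap.sub_apply, LinearMap.sum_apply, LinearMap.smul_apply, hF.h_normalPart_dF, smul_zero,
    Finset.sum_const_zero, sub_zero]

variable [IsManifold (𝓡 n) ∞ M] [IsManifold (𝓡 n) ∞ N]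

theorem KMStructure.IsSpacelikeLagrangian.h_covDeriv (hF : X.IsSpacelikeLagrangian F) {p : L}
    {c : E n × E n → ℝ} (hc : X.IsLocalCost (F p) c) (i j : Fin n) (w : TangentSpace (𝓡 n) p) :
    X.h (F p) (X.covDeriv F p i j) (K (F p) (dF F p w)) =
      -curvatureTerm c (coordMap F p) (extChartAt (𝓡 n) p p) (EuclideanSpace.single i 1)
        (EuclideanSpace.single j 1) w := by
  have hz := hF.notMem_cutLocus p
  have hD := (((contDiffAt_coordMap hF.contMDiff p).fderiv_right (m := 1)
    (by norm_num)).differentiableAt (by norm_num)).hasFDerivAt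
  have hS : fderiv ℝ (fun x => fderiv ℝ (coordMap F p) x (EuclideanSpace.single j 1))
      (extChartAt (𝓡 n) p p) (EuclideanSpace.single i 1) =
      fderiv ℝ (fderiv ℝ (coordMap F p)) (extChartAt (𝓡 n) p p) (EuclideanSpace.single i 1)
        (EuclideanSpace.single j 1) := by
    rw [(hD.clm_apply (hasFDerivAt_const _ _)).fderiv]
    simp
  have hsum : ∀ S C W : Tan n (F p), X.h (F p) (S + C) W = X.h (F p) S W + X.h (F p) C W :=
    fun S C W => by rw [map_add, LinearMap.add_apply]
  have hdh : ∀ a b d : E n × E n,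
      (X.dh (F p) a b (d.1, -d.2) + X.dh (F p) b a (d.1, -d.2) - X.dh (F p) (d.1, -d.2) a b) / 2 =
        -dCostForm c (extChartAt (prodModel n) (F p) (F p)) (a.1, 0) b.1 d.2 +
          dCostForm c (extChartAt (prodModel n) (F p) (F p)) (0, a.2) d.1 b.2 := fun a b d => by
    rw [hc.dh_eq, hc.dh_eq, hc.dh_eq, koszul_paraComplex hc.contDiffAt]
  refine (hsum _ _ _).trans ((congrArg₂ (· + ·) (hc.h_self_apply hz _ _)
    ((hc.h_christoffel hz _ _ _).trans (hdh _ _ (dF F p w)))).trans ?_)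
  refine (congrArg (fun S : E n × E n =>
    costForm c (extChartAt (prodModel n) (F p) (F p)) S.1 (-(dF F p w).2) +
      costForm c (extChartAt (prodModel n) (F p) (F p)) (dF F p w).1 S.2 + _) hS).trans ?_
  rw [dF_self hF.contMDiff, dF_self hF.contMDiff, dF_self hF.contMDiff, ← coordMap_self, map_neg]
  simp only [curvatureTerm, coordVec]
  ring

/-- The form `α` of the generalized mean curvature vector, in the preferred charts. -/
theorem GKMStructure.alpha_genMeanCurvature {X : GKMStructure n M N} {ψ : M × N → ℝ}
    (hF : X.IsSpacelikeLagrangian F) {p : L} {c : E n × E n → ℝ} (hc : X.IsLocalCost (F p) c)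
    (hψ : DifferentiableAt ℝ (ψ ∘ unchart n (F p)) (extChartAt (prodModel n) (F p) (F p)))
    (w : TangentSpace (𝓡 n) p) :
    X.alpha F (X.genMeanCurvature ψ F) p w =
      ∑ i, ∑ j, (Matrix.of fun i j => X.g F p (coordVec p i) (coordVec p j))⁻¹ i j *
        curvatureTerm c (coordMap F p) (extChartAt (𝓡 n) p p) (EuclideanSpace.single i 1)
          (EuclideanSpace.single j 1) w +
      n * fderiv ℝ (ψ ∘ unchart n (F p)) (extChartAt (prodModel n) (F p) (F p))
        ((fderiv ℝ (coordMap F p) (extChartAt (𝓡 n) p p) w).1,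
          -(fderiv ℝ (coordMap F p) (extChartAt (𝓡 n) p p) w).2) := by
  have hz := hF.notMem_cutLocus p
  have hd : (mfderiv (prodModel n) 𝓘(ℝ, ℝ) ψ (F p) (K (F p) (dF F p w)) : ℝ) =
      fderiv ℝ (ψ ∘ unchart n (F p)) (extChartAt (prodModel n) (F p) (F p))
        ((fderiv ℝ (coordMap F p) (extChartAt (𝓡 n) p p) w).1,
          -(fderiv ℝ (coordMap F p) (extChartAt (𝓡 n) p p) w).2) := by
    rw [← dF_self hF.contMDiff]
    exact mfderiv_of_chart_self (I := prodModel n) Filter.EventuallyEq.rfl hψ _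
  rw [KMStructure.alpha, X.omega_eq_neg hz, KMStructure.genMeanCurvature,
    KMStructure.meanCurvature]
  simp only [map_sub, map_sum, map_smul, LinearMap.sub_apply, LinearMap.sum_apply,
    LinearMap.smul_apply, smul_eq_mul, hF.h_normalPart, hF.h_covDeriv hc, X.h_grad hz, mul_neg,
    Finset.sum_neg_distrib]
  rw [hd]
  ring

variable [IsManifold (𝓡 n) ∞ L]

theorem contMDiffAt_of_chart {θ : L → ℝ} {p : L}
    (h : ContDiffAt ℝ 1 (θ ∘ (extChartAt (𝓡 n) p).symm) (extChartAt (𝓡 n) p p)) :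
    ContMDiffAt (𝓡 n) 𝓘(ℝ, ℝ) 1 θ p := by
  have : IsManifold (𝓡 n) 1 L := IsManifold.of_le (n := ∞) (by simp)
  refine (h.contMDiffAt.comp p
    (contMDiffAt_extChartAt (I := 𝓡 n) (n := 1))).congr_of_eventuallyEq ?_
  filter_upwards [extChartAt_source_mem_nhds (I := 𝓡 n) p] with q hq
  simp only [Function.comp_apply, (extChartAt (𝓡 n) p).left_inv hq]

theorem GKMStructure.lagrangianAngle_properties (hn : n ≠ 0) {X : GKMStructure n M N}
    {ψ : M × N → ℝ} (hψ : X.IsPsi ψ) (hF : X.IsSpacelikeLagrangian F) {θ : L → ℝ}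
    (hθ : X.IsLagrangianAngle ψ F θ) :
    ContMDiff (𝓡 n) 𝓘(ℝ, ℝ) 1 θ ∧
    (∀ (p : L) (w : TangentSpace (𝓡 n) p),
      mfderiv (𝓡 n) 𝓘(ℝ, ℝ) θ p w = X.alpha F (X.genMeanCurvature ψ F) p w) ∧
    ∀ p : L, dF F p (X.gradL F θ p) = K (F p) (X.genMeanCurvature ψ F p) := by
  have key : ∀ p : L, ContMDiffAt (𝓡 n) 𝓘(ℝ, ℝ) 1 θ p ∧ ∀ w : TangentSpace (𝓡 n) p,
      mfderiv (𝓡 n) 𝓘(ℝ, ℝ) θ p w = X.alpha F (X.genMeanCurvature ψ F) p w := by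
    intro p
    obtain ⟨c, hc⟩ := X.exists_isLocalCost (hF.notMem_cutLocus p)
    obtain ⟨h1, h2, h3⟩ := X.fderiv_lagrangianAngle hn hψ hF hθ hc
    refine ⟨contMDiffAt_of_chart h1, fun w => ?_⟩
    exact (mfderiv_of_chart_self Filter.EventuallyEq.rfl (h1.differentiableAt (by norm_num))
      w).trans ((h3 w).trans (X.alpha_genMeanCurvature hF hc h2 w).symm)
  refine ⟨fun p => (key p).1, fun p => (key p).2, fun p => ?_⟩
  refine hF.dF_eq_K p (hF.h_genMeanCurvature_dF ψ p) fun w => ?_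
  exact (sharp_spec (hF.g_nondegenerate p) (mfderiv (𝓡 n) 𝓘(ℝ, ℝ) θ p).toLinearMap
    (fun _ => rfl) w).trans ((key p).2 w)

end MeanCurvature

end KimMcCann

end

theorem mainTheorem3 (n : ℕ) (hn : 2 ≤ n)
    {M : Type*} [TopologicalSpace M] [ChartedSpace (KimMcCann.E n) M]
    [IsManifold (𝓡 n) ∞ M] [CompactSpace M]
    {N : Type*} [TopologicalSpace N] [ChartedSpace (KimMcCann.E n) N]
    [IsManifold (𝓡 n) ∞ N] [CompactSpace N]
    {L : Type*} [TopologicalSpace L] [ChartedSpace (KimMcCann.E n) L]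
    [IsManifold (𝓡 n) ∞ L]
    (X : KimMcCann.GKMStructure n M N) (ψ : M × N → ℝ) (hψ : X.IsPsi ψ)
    (F : L → M × N) (hF : X.IsSpacelikeLagrangian F) :
    (∃! θ : L → ℝ, X.IsLagrangianAngle ψ F θ) ∧
    (∀ θ : L → ℝ, X.IsLagrangianAngle ψ F θ →
      ContMDiff (𝓡 n) 𝓘(ℝ, ℝ) 1 θ ∧
      (∀ (p : L) (w : TangentSpace (𝓡 n) p),
        mfderiv (𝓡 n) 𝓘(ℝ, ℝ) θ p w = X.alpha F (X.genMeanCurvature ψ F) p w) ∧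
      (∀ p : L, KimMcCann.dF F p (X.gradL F θ p) =
        KimMcCann.K (F p) (X.genMeanCurvature ψ F p))) ∧
    KimMcCann.IsExact (X.alpha F (X.genMeanCurvature ψ F)) := by
  have hn' : n ≠ 0 := by omega
  have hex := X.existsUnique_lagrangianAngle hψ hF
  refine ⟨hex, fun θ hθ => X.lagrangianAngle_properties hn' hψ hF hθ, ?_⟩
  obtain ⟨θ, hθ, -⟩ := hex
  obtain ⟨h₁, h₂, -⟩ := X.lagrangianAngle_properties hn' hψ hF hθ
  exact ⟨θ, h₁, h₂⟩
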